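/- All circuits have unbounded fan-in $\mathsf{AND}$ and $\mathsf{OR}$ gates, are directed acyclic graphs with literals as leaves, are alternating (every root-to-leaf path alternates between $\mathsf{AND}$ and $\mathsf{OR}$ gates) and layered (all paths from the root to a given gate have the same length); the size is the number of gates, and depth $d$ means that root-to-leaf paths have length at most $d$. The width of a CNF (DNF) is the maximum number of variables in a clause (term). $\log$ is to base $2$. **Parameters.** For integers $m\ge 1$ and $d\ge 2$ let $p=2^{-m}$, $q=\sqrt p$, $w=\lfloor m2^m/\log e\rfloor$, $\lambda=(\log w)^{3/2}/w^{5/4}$, $t_{d-1}=(p-\lambda)/q$ and $t_{k-1}=((1-t_k)^{qw}-\lambda)/q$ for $k=d-1,\dots,2$. Let $w_{d-1}=m$, $w_k=w$ for $1\le k\le d-2$, and let $w_0$ be the smallest integer with $(1-t_1)^{qw_0}\le\frac12$. Put $n=\prod_{k=0}^{d-1}w_k$, let $A_0$ be a one-point set and $A_{k+1}=A_k\times[w_k]$, so $|A_d|=n$ and $|A_1|=w_0$. At level $k$ let $\circ=1,\ \bullet=0$ if $d-k$ is even and $\circ=0,\ \bullet=1$ if $d-k$ is odd. **Projections and lifts.**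 For $\rho\in\{0,1,*\}^{A_k}$ with $A_k=A_{k-1}\times[w_{k-1}]$ and $f:\{0,1\}^{A_k}\to\{0,1\}$, let $(\mathrm{proj}_\rho f)(y)=f(x)$, where $x_{a,i}=y_a$ if $\rho_{a,i}=*$ and $x_{a,i}=\rho_{a,i}$ otherwise. The lift $\hat\rho\in\{0,1,*\}^{A_{k-1}}$ is given (with $\circ,\bullet$ of level $k$ for $\rho$ and of level $k-1$ for $\hat\rho$) by $\hat\rho_a=\circ$ if some $\rho_{a,i}=\bullet$, $\hat\rho_a=\bullet$ if all $\rho_{a,i}=\circ$, and $\hat\rho_a=*$ otherwise. **Random projections.** $\{u_s,v_{1-s}\}^T$ denotes the product distribution in which each coordinate is $u$ with probability $s$ and $v$ with probability $1-s$; "$\setminus\{v\}^T$" denotes conditioning on the outcome not being $v^T$. * $\mathcal R_{\mathrm{init}}$ on $\{0,1,*\}^{A_{d-1}\times[m]}$: independently for each $a\in A_{d-1}$, the block $\rho_a$ is $\{1\}^m$ with probability $\lambda$, is drawn from $\{*_{1/2},1_{1/2}\}^m\setminus\{1\}^m$ with probability $q$, and from $\{0_{1/2},1_{1/2}\}^m\setminus\{1\}^m$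 with probability $1-\lambda-q$. * $\mathcal R(\tau)$ for $\tau\in\{\bullet,\circ,*\}^{A_k}$, $2\le k\le d-1$: $\rho$ agrees with $\tau$ where $\tau\ne *$, and independently for each $a\in A_{k-1}$, with $S_a=\{i:\tau_{a,i}=*\}$: if $\hat\tau_a=\circ$ or $\big||S_a|-qw\big|>w^{\beta}$, where $\beta=\frac13+\frac{d-k-1}{12d}$, then $\rho(S_a)\leftarrow\{\bullet_{t_k},\circ_{1-t_k}\}^{S_a}$; if $\hat\tau_a=*$ and $\big||S_a|-qw\big|\le w^{\beta}$, then $\rho(S_a)$ is $\circ^{S_a}$ with probability $\lambda$, is drawn from $\{*_{t_k},\circ_{1-t_k}\}^{S_a}\setminus\{\circ\}^{S_a}$ with probability $q_a$ and from $\{\bullet_{t_k},\circ_{1-t_k}\}^{S_a}\setminus\{\circ\}^{S_a}$ with probability $1-\lambda-q_a$, where $q_a=\big((1-t_k)^{|S_a|}-\lambda\big)/t_{k-1}$. Let $\rho^{(d)}\leftarrow\mathcal R_{\mathrm{init}}$, $\rho^{(k)}\leftarrow\mathcal R(\widehat{\rho^{(k+1)}})$ for $k=d-1,\dots,2$, and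 $\mathbf\Psi(f)=\mathrm{proj}_{\rho^{(2)}}\cdots\mathrm{proj}_{\rho^{(d)}}f:\{0,1\}^{A_1}\to\{0,1\}$ for $f:\{0,1\}^{A_d}\to\{0,1\}$. Let $\mathcal D$ be the product distribution on $\{0,1\}^{A_1}$ in which each bit is $1$ with probability $t_1$ if $d$ is even and $1-t_1$ if $d$ is odd. Functions $g,h$ on $\{0,1\}^{A_1}$ are called $\varepsilon$-close if $\Pr[g(Y)\ne h(Y)]\le\varepsilon$ both for uniform $Y$ and for $Y\leftarrow\mathcal D$. **Theorem.** There are absolute constants $c,\kappa>0$ and $m_0$ such that the following holds for all $m\ge m_0$ and all $d\ge 2$ with $d\le \frac{c\sqrt{\log n}}{\log\log n}$ and $d\le\frac{cm}{\log m}$. The mixtures above are genuine probability distributions: $\mathcal R_{\mathrm{init}}$, $\mathcal R(\tau)$ for all $\tau\in\{0,1,*\}^{A_k}$ with $2\le k\le d-1$, and the law of $(\rho^{(d)},\dots,\rho^{(2)})$. Moreover, let $C:\{0,1\}^{A_d}\to\{0,1\}$ be a depth-$d$ circuit of size $S\le 2^{\frac12 n^{1/(6(d-1))}}$ (with no bound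 on the bottom fan-in). 1. If the top gate of $C$ is an $\mathsf{AND}$, then with probability at least $1-\exp\big(-\kappa\, n^{1/(6(d-1))}\big)$ the function $\mathbf\Psi(C)$ is $(1/S)$-close to a CNF of width at most $n^{1/(4(d-1))}$. 2. If the top gate of $C$ is an $\mathsf{OR}$, then with probability at least $1-\exp\big(-\kappa\, n^{1/(6(d-1))}\big)$ the function $\mathbf\Psi(C)$ is $(1/S)$-close to a DNF of width at most $n^{1/(4(d-1))}$. -/

import Mathlib

/-! Boolean circuits, CNFs and DNFs -/

/-- A literal over the variables `V`: `(v, true)` is `v` and `(v, false)` is its negation. -/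
abbrev BoolLit (V : Type) := V × Bool

/-- The truth value of a literal under an assignment. -/
def BoolLit.val {V : Type} (x : V → Bool) (l : BoolLit V) : Bool := x l.1 == l.2

/-- An unbounded fan-in Boolean circuit (a directed acyclic graph, so gates may be shared) with
`AND` and `OR` gates whose inputs are literals and other gates.
`size` is the number of gates; the gates are numbered topologically, inputs before outputs.
`isAnd g` tells whether the gate `g` is an `AND` gate (otherwise it is an `OR` gate). -/
structure BoolCircuit (V : Type) where
  size : ℕ
  isAnd : Fin size → Bool
  lits : Fin size → Finset (BoolLit V)
  inputs : Fin size → Finset (Fin size)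
  acyclic : ∀ g, ∀ h ∈ inputs g, h < g
  out : Fin size

namespace BoolCircuit

/-- The value that the gate `g` takes on the assignment `x`. -/
def gateVal {V : Type} (C : BoolCircuit V) (x : V → Bool) (g : Fin C.size) : Bool :=
  if C.isAnd g then
    decide ((∀ l ∈ C.lits g, l.val x = true) ∧
      ∀ h : {h // h ∈ C.inputs g}, C.gateVal x h.1 = true)
  else
    decide ((∃ l ∈ C.lits g, l.val x = true) ∨
      ∃ h : {h // h ∈ C.inputs g}, C.gateVal x h.1 = true)
termination_by g.val
decreasing_by all_goals exact C.acyclic g _ (Subtype.property _)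

/-- The Boolean function computed by the circuit. -/
def eval {V : Type} (C : BoolCircuit V) (x : V → Bool) : Bool := C.gateVal x C.out

/-- `C.HasPath k g`: some directed path from the output gate down to `g` has exactly `k` edges. -/
inductive HasPath {V : Type} (C : BoolCircuit V) : ℕ → Fin C.size → Prop
  | out : HasPath C 0 C.out
  | step {k : ℕ} {g h : Fin C.size} : HasPath C k g → h ∈ C.inputs g → HasPath C (k + 1) h

/-- Every root-to-leaf path alternates between `AND` gates and `OR` gates. -/
def Alternating {V : Type} (C : BoolCircuit V) : Prop :=
  ∀ k g h, C.HasPath k g → h ∈ C.inputs g → C.isAnd h ≠ C.isAnd g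

/-- For every gate, all paths from the root to this gate have the same length. -/
def Layered {V : Type} (C : BoolCircuit V) : Prop :=
  ∀ k k' g, C.HasPath k g → C.HasPath k' g → k = k'

/-- Every root-to-leaf path has length at most `d`: the leaves below a gate that is reached by a
path with `k` edges end paths with `k + 1` edges. -/
def DepthLE {V : Type} (C : BoolCircuit V) (d : ℕ) : Prop :=
  ∀ k g, C.HasPath k g → k + 1 ≤ d

end BoolCircuit

/-- A set of sets of literals, read either as a CNF (a conjunction of clauses)
or as a DNF (a disjunction of terms). -/
abbrev NormalForm (V : Type) := Finset (Finset (BoolLit V))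

namespace NormalForm

def evalCNF {V : Type} (F : NormalForm V) (x : V → Bool) : Bool :=
  decide (∀ c ∈ F, ∃ l ∈ c, BoolLit.val x l = true)

def evalDNF {V : Type} (F : NormalForm V) (x : V → Bool) : Bool :=
  decide (∃ c ∈ F, ∀ l ∈ c, BoolLit.val x l = true)

/-- The maximum number of variables that occur in one clause (or term). -/
def width {V : Type} [DecidableEq V] (F : NormalForm V) : ℕ :=
  F.sup fun c => (c.image Prod.fst).card

end NormalForm

/-! Finite probability by mass functions -/

/-- `f` is the mass function of a probability distribution on the finite type `α`. -/
def IsProbMass {α : Type} [Fintype α] (f : α → ℝ) : Prop :=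
  (∀ a, 0 ≤ f a) ∧ ∑ a, f a = 1

open Classical in
/-- The probability of the event `E` under the mass function `f`. -/
noncomputable def massProb {α : Type} [Fintype α] (f : α → ℝ) (E : α → Prop) : ℝ :=
  ∑ a, if E a then f a else 0

/-- The distribution on one symbol that gives `u` with probability `t` and `v` with
probability `1 - t` (for `u ≠ v`). -/
noncomputable def twoPoint {α : Type} [DecidableEq α] (u : α) (t : ℝ) (v : α) : α → ℝ :=
  fun x => if x = u then t else if x = v then 1 - t else 0

/-- The product distribution with all coordinates distributed as `f`. -/
noncomputable def productMass {ι α : Type} [Fintype ι] (f : α → ℝ) : (ι → α) → ℝ :=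
  fun x => ∏ i, f (x i)

/-- The distribution `f` conditioned on the outcome not being `z`. -/
noncomputable def condNe {α : Type} [DecidableEq α] (f : α → ℝ) (z : α) : α → ℝ :=
  fun x => if x = z then 0 else f x / (1 - f z)

/-- The `t`-biased product distribution on `{0,1}^ι`: each bit is `1` with probability `t`. -/
noncomputable def biasedMass {ι : Type} [Fintype ι] (t : ℝ) : (ι → Bool) → ℝ :=
  productMass (twoPoint true t false)

/-- The Boolean functions `f` and `g` differ with probability at most `ε` when the input is drawn
from the distribution with mass function `μ`. -/
def CloseUnder {α : Type} [Fintype α] (μ : α → ℝ) (ε : ℝ) (f g : α → Bool) : Prop :=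
  massProb μ (fun x => f x ≠ g x) ≤ ε

namespace SipserProj

/-! The parameters. In what follows `m` is the bottom fan-in and `d` the depth. -/

/-- `p = 2^{-m}`. -/
noncomputable def p (m : ℕ) : ℝ := 2 ^ (-(m : ℝ))

/-- `q = √p = 2^{-m/2}`. -/
noncomputable def q (m : ℕ) : ℝ := √(p m)

/-- `w = ⌊m 2^m / log₂ e⌋`. -/
noncomputable def w (m : ℕ) : ℕ := ⌊(m : ℝ) * 2 ^ m / Real.logb 2 (Real.exp 1)⌋₊

/-- `λ = (log₂ w)^{3/2} / w^{5/4}`. -/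
noncomputable def lam (m : ℕ) : ℝ :=
  Real.logb 2 (w m) ^ (3 / 2 : ℝ) / (w m : ℝ) ^ (5 / 4 : ℝ)

/-- The sequence `t_{d-1}, t_{d-2}, …`, listed from its start. -/
noncomputable def tAux (m : ℕ) : ℕ → ℝ
  | 0 => (p m - lam m) / q m
  | j + 1 => ((1 - tAux m j) ^ (q m * (w m : ℝ)) - lam m) / q m

/-- `t_k` for `1 ≤ k ≤ d - 1`. -/
noncomputable def t (m d k : ℕ) : ℝ := tAux m (d - 1 - k)

/-- The top fan-in `w_0`: the least integer with `(1 - t_1)^{q w_0} ≤ 1/2`. -/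
noncomputable def w0 (m d : ℕ) : ℕ :=
  sInf {r : ℕ | (1 - t m d 1) ^ (q m * (r : ℝ)) ≤ 1 / 2}

/-- The fan-in `w_k` of the gates at depth `k` of the Sipser formula, `0 ≤ k ≤ d - 1`. -/
noncomputable def fanIn (m d k : ℕ) : ℕ :=
  if k = 0 then w0 m d else if k = d - 1 then m else w m

/-- The number `n` of variables of the Sipser formula. -/
noncomputable def numVars (m d : ℕ) : ℕ := ∏ k ∈ Finset.range d, fanIn m d k

/-- The set `A_k` of addresses of the nodes at depth `k`: `A_0` has one element and
`A_{k+1} = A_k × [w_k]`. -/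
def Addr (m d : ℕ) : ℕ → Type
  | 0 => Unit
  | k + 1 => Addr m d k × Fin (fanIn m d k)

noncomputable instance instFintypeAddr (m d : ℕ) : (k : ℕ) → Fintype (Addr m d k)
  | 0 => inferInstanceAs (Fintype Unit)
  | k + 1 =>
    letI := instFintypeAddr m d k
    inferInstanceAs (Fintype (Addr m d k × Fin (fanIn m d k)))

noncomputable instance instDecidableEqAddr (m d : ℕ) : (k : ℕ) → DecidableEq (Addr m d k)
  | 0 => inferInstanceAs (DecidableEq Unit)
  | k + 1 =>
    letI := instDecidableEqAddr m d k
    inferInstanceAs (DecidableEq (Addr m d k × Fin (fanIn m d k)))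

/-- The variables of the circuits are addressed by `A_d`, and there are `n` of them. -/
theorem card_addr (m d : ℕ) : Fintype.card (Addr m d d) = numVars m d := by
  have h : ∀ k, Fintype.card (Addr m d k) = ∏ j ∈ Finset.range k, fanIn m d j := by
    intro k
    induction k with
    | zero => exact Fintype.card_unit
    | succ k ih =>
      rw [Finset.prod_range_succ, ← ih]
      exact (Fintype.card_prod _ _).trans (by rw [Fintype.card_fin])
  exact h d

/-! Restrictions, projections and lifts -/

/-- A restriction in `{0,1,*}^{A_k}`; `none` stands for `*`. -/
abbrev Restr (m d k : ℕ) := Addr m d k → Option Bool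

/-- The projection `proj_ρ f : {0,1}^{A_k} → {0,1}` of `f : {0,1}^{A_{k+1}} → {0,1}`. -/
noncomputable def proj {m d k : ℕ} (ρ : Restr m d (k + 1)) (f : (Addr m d (k + 1) → Bool) → Bool) :
    (Addr m d k → Bool) → Bool :=
  fun y => f fun b : Addr m d k × Fin (fanIn m d k) => (ρ b).getD (y b.1)

/-- The value of the symbol `∘` in `{0,1}^{A_k}`: it is `1` if `d - k` is even, `0` if it is odd.
The symbol `•` is its complement. -/
def circ (d k : ℕ) : Bool := decide (Even (d - k))

/-- The block `τ_a` of a restriction `τ` in `{0,1,*}^{A_k × [w_k]}`. -/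
noncomputable def block {m d k : ℕ} (τ : Restr m d (k + 1)) (a : Addr m d k) :
    Fin (fanIn m d k) → Option Bool :=
  fun i => τ (a, i)

/-- The lift of `τ`, a restriction in `{0,1,*}^{A_k}` if `τ` is one in `{0,1,*}^{A_{k+1}}`. -/
noncomputable def lift {m d k : ℕ} (τ : Restr m d (k + 1)) : Restr m d k := fun a =>
  if ∃ i, block τ a i = some (!circ d (k + 1)) then some (circ d k)
  else if ∀ i, block τ a i = some (circ d (k + 1)) then some (!circ d k)
  else none

/-! The random restrictions -/

/-- The mixture of
`{c}^ι` with probability `l`,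
`{*_s, c_{1-s}}^ι` conditioned on not being `{c}^ι` with probability `r`,
`{c'_s, c_{1-s}}^ι` conditioned on not being `{c}^ι` with probability `1 - l - r`,
where `c'` is the complement of `c`. -/
noncomputable def mixMass {ι : Type} [Fintype ι] [DecidableEq ι] (c : Bool) (s l r : ℝ) :
    (ι → Option Bool) → ℝ := fun x =>
  l * (if x = (fun _ => some c) then 1 else 0)
    + r * condNe (productMass (twoPoint none s (some c))) (fun _ => some c) x
    + (1 - l - r) * condNe (productMass (twoPoint (some (!c)) s (some c))) (fun _ => some c) x

/-- The initial random restriction, for `k + 1 = d`: the blocks are independent. -/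
noncomputable def initMass (m d k : ℕ) (ρ : Restr m d (k + 1)) : ℝ :=
  ∏ a : Addr m d k, mixMass (circ d (k + 1)) (1 / 2) (lam m) (q m) (block ρ a)

/-- `S_a(τ)`: the set of stars in the block `τ_a`. -/
noncomputable def stars {m d k : ℕ} (τ : Restr m d (k + 1)) (a : Addr m d k) : Finset (Fin (fanIn m d k)) :=
  Finset.univ.filter fun i => block τ a i = none

/-- `β(k,d) = 1/3 + (d-k-1)/(12d)`. -/
noncomputable def beta (k d : ℕ) : ℝ := 1 / 3 + ((d : ℝ) - (k : ℝ) - 1) / (12 * (d : ℝ))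

/-- A set with `s` elements is `k`-acceptable: `s = qw ± w^{β(k,d)}`. -/
def Acceptable (m d k s : ℕ) : Prop :=
  |(s : ℝ) - q m * (w m : ℝ)| ≤ (w m : ℝ) ^ beta k d

/-- `q_a` for a block with `s` stars: `(1 - t_k)^s = λ + q_a t_{k-1}`. -/
noncomputable def qBlock (m d k s : ℕ) : ℝ := ((1 - t m d k) ^ s - lam m) / t m d (k - 1)

open Classical in
/-- The distribution of `ρ(S_a)`, the part of the block `ρ_a` in which `τ_a` has stars, for the
random restriction of level `k + 1` that refines `τ`. -/
noncomputable def blockMass {m d k : ℕ} (τ : Restr m d (k + 1)) (a : Addr m d k) :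
    ({i // i ∈ stars τ a} → Option Bool) → ℝ :=
  if lift τ a = some (circ d k) ∨ ¬ Acceptable m d (k + 1) (stars τ a).card then
    productMass (twoPoint (some (!circ d (k + 1))) (t m d (k + 1)) (some (circ d (k + 1))))
  else if lift τ a = none then
    mixMass (circ d (k + 1)) (t m d (k + 1)) (lam m) (qBlock m d (k + 1) (stars τ a).card)
  else
    -- here `τ_a` has no stars, and this is the mass function of the empty string
    fun _ => 1

/-- The subsequent random restriction `R(τ)`, for `2 ≤ k + 1 ≤ d - 1`: it refines `τ`, and its
blocks are independent. -/
noncomputable def subseqMass {m d k : ℕ} (τ : Restr m d (k + 1)) (ρ : Restr m d (k + 1)) : ℝ :=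
  if ∀ b, τ b ≠ none → ρ b = τ b then
    ∏ a : Addr m d k, blockMass τ a fun i => block ρ a i.1
  else 0

/-! The composed random projection `Ψ` -/

/-- The possible values of `(ρ^{(k)}, ρ^{(k-1)}, …, ρ^{(2)})`. -/
def Outcome (m d : ℕ) : ℕ → Type
  | 0 => Unit
  | 1 => Unit
  | k + 2 => Restr m d (k + 2) × Outcome m d (k + 1)

noncomputable instance instFintypeOutcome (m d : ℕ) : (k : ℕ) → Fintype (Outcome m d k)
  | 0 => inferInstanceAs (Fintype Unit)
  | 1 => inferInstanceAs (Fintype Unit)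
  | k + 2 =>
    letI := instFintypeOutcome m d (k + 1)
    inferInstanceAs (Fintype (Restr m d (k + 2) × Outcome m d (k + 1)))

/-- The distribution of `(ρ^{(k)}, …, ρ^{(2)})` where `ρ^{(k)}` is drawn from `R(τ)` and then
`ρ^{(j)}` from `R` of the lift of `ρ^{(j+1)}`, for `j = k - 1, …, 2`. -/
noncomputable def tailMass (m d : ℕ) : (k : ℕ) → Restr m d k → Outcome m d k → ℝ
  | 0, _, _ => 1
  | 1, _, _ => 1
  | k + 2, τ, ω => subseqMass τ ω.1 * tailMass m d (k + 1) (lift ω.1) ω.2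

/-- The distribution of `(ρ^{(d)}, …, ρ^{(2)})`: the restriction `ρ^{(d)}` is drawn from the initial
distribution, and then `ρ^{(j)}` from `R` of the lift of `ρ^{(j+1)}`, for `j = d - 1, …, 2`. -/
noncomputable def psiMass (m : ℕ) : (d : ℕ) → Outcome m d d → ℝ
  | 0, _ => 1
  | 1, _ => 1
  | d + 2, ω => initMass m (d + 2) (d + 1) ω.1 * tailMass m (d + 2) (d + 1) (lift ω.1) ω.2

/-- The projection `proj_{ρ^{(2)}} ⋯ proj_{ρ^{(k)}} f` of `f : {0,1}^{A_k} → {0,1}`, a function on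
`{0,1}^{A_1}` (only meaningful for `k ≥ 1`). -/
noncomputable def psi {m d : ℕ} : (k : ℕ) → Outcome m d k → ((Addr m d k → Bool) → Bool) →
    ((Addr m d 1 → Bool) → Bool)
  | 0, _, f => fun _ => f fun _ => false
  | 1, _, f => f
  | k + 2, ω, f => psi (k + 1) ω.2 (proj ω.1 f)

/-- The random restrictions are genuine probability distributions: so is the initial one, so are
the `R(τ)` for all `τ` in `{0,1,*}^{A_k}` with `2 ≤ k ≤ d - 1`, and so is the law of their
composition. -/
def WellDefined (m d : ℕ) : Prop :=
  IsProbMass (initMass m d (d - 1)) ∧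
    (∀ k, 2 ≤ k + 1 → k + 1 ≤ d - 1 → ∀ τ : Restr m d (k + 1), IsProbMass (subseqMass τ)) ∧
    IsProbMass (psiMass m d)

/-- The product distribution on `{0,1}^{A_1}` that the projections turn into the uniform
distribution on `{0,1}^n`: every bit is `1` with probability `t_1` if `d` is even, and with
probability `1 - t_1` if `d` is odd. -/
noncomputable def topMass (m d : ℕ) : (Addr m d 1 → Bool) → ℝ :=
  biasedMass (if Even d then t m d 1 else 1 - t m d 1)

/-- `f` and `g` are `ε`-close under the uniform distribution on `{0,1}^{A_1}`, and also under the
product distribution `topMass`. -/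
def Close (m d : ℕ) (ε : ℝ) (f g : (Addr m d 1 → Bool) → Bool) : Prop :=
  CloseUnder (biasedMass (1 / 2)) ε f g ∧ CloseUnder (topMass m d) ε f g

end SipserProj

/-! Certificates -/

/-- Every input of `f` has a certificate of size at most `s`: some `s` coordinates of the input
determine the value. -/
def CertLE {V : Type} (f : (V → Bool) → Bool) (s : ℕ) : Prop :=
  ∀ y, ∃ Y : Finset V, Y.card ≤ s ∧ ∀ y', (∀ v ∈ Y, y' v = y v) → f y' = f y

/-! The switching lemma for projections of independent blocks -/

namespace Switching

open Finset Function

theorem sum_powerset_erase_le {A : Type} [DecidableEq A] (S : Finset A) {r : ℕ} (hS : S.card ≤ r) {δ γ : ℝ} (hδ : 0 ≤ δ)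
    (hγ0 : 0 < γ) (hγ1 : γ ≤ 1) (hr : (1 + 2 * δ / γ) ^ r ≤ 2) (s : ℕ) :
    ∑ B ∈ S.powerset.erase ∅, (2 : ℝ) ^ B.card * (γ ^ (s - B.card) * δ ^ B.card) ≤ γ ^ s := by
  set c := 2 * δ / γ with hc
  have hc0 : 0 ≤ c := by positivity
  have h1 : ∀ B : Finset A, (2 : ℝ) ^ B.card * (γ ^ (s - B.card) * δ ^ B.card) ≤
      γ ^ s * c ^ B.card := by
    intro B
    have h2 : γ ^ (s - B.card) * γ ^ B.card ≤ γ ^ s * 1 := by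
      rw [← pow_add, mul_one]
      exact pow_le_pow_of_le_one hγ0.le hγ1 (by omega)
    have h3 : (2 : ℝ) ^ B.card * (γ ^ (s - B.card) * δ ^ B.card) =
        (γ ^ (s - B.card) * γ ^ B.card) * c ^ B.card := by
      rw [hc, div_pow, mul_pow]
      field_simp
    rw [h3]
    gcongr
    linarith
  refine (sum_le_sum fun B _ => h1 B).trans ?_
  have h4 : ∑ B ∈ S.powerset, c ^ B.card = (c + 1) ^ S.card := by
    simpa using sum_pow_mul_eq_add_pow c 1 S
  have h5 : ∑ B ∈ S.powerset.erase ∅, c ^ B.card = (c + 1) ^ S.card - 1 := by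
    rw [← h4, ← sum_erase_add _ _ (empty_mem_powerset S)]
    simp
  rw [← mul_sum, h5]
  have h6 : (c + 1) ^ S.card ≤ 2 :=
    (pow_le_pow_right₀ (by linarith) hS).trans (by rwa [add_comm])
  have : 0 ≤ γ ^ s := by positivity
  nlinarith

section Local

variable {κ : Type}

/-- The partial assignment `x` contradicts the term `z`. -/
def Fals (z x : κ → Option Bool) : Prop := ∃ i b, z i = some b ∧ x i = some (!b)

/-- The partial assignment `x` satisfies the term `z`. -/
def Sat (z x : κ → Option Bool) : Prop := ∀ i b, z i = some b → x i = some b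

/-- The term `z` holds if all stars of `x` are replaced by `c`. -/
def Answered (z x : κ → Option Bool) (c : Bool) : Prop := ∀ i b, z i = some b → (x i).getD c = b

/-- The partial assignment `y` extends `x`. -/
def Refines (x y : κ → Option Bool) : Prop := ∀ i, x i ≠ none → y i = x i

theorem Fals.mono {z x y : κ → Option Bool} (h : Fals z x) (hxy : Refines x y) : Fals z y := by
  obtain ⟨i, b, h1, h2⟩ := h
  exact ⟨i, b, h1, by rw [hxy i (by simp [h2]), h2]⟩

theorem Sat.mono {z x y : κ → Option Bool} (h : Sat z x) (hxy : Refines x y) : Sat z y := by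
  intro i b hi
  rw [hxy i (by simp [h i b hi]), h i b hi]

theorem Sat.answered {z x : κ → Option Bool} (h : Sat z x) (c : Bool) : Answered z x c := by
  intro i b hi
  simp [h i b hi]

theorem Fals.not_answered {z x : κ → Option Bool} (h : Fals z x) (c : Bool) :
    ¬ Answered z x c := by
  obtain ⟨i, b, h1, h2⟩ := h
  intro h3
  have := h3 i b h1
  simp [h2] at this

theorem Sat.not_fals {z x : κ → Option Bool} (h : Sat z x) : ¬ Fals z x :=
  fun h' => h'.not_answered true (h.answered true)

open Classical in
/-- Blocks drawn from `μ` that leave a term of width at most `r` undetermined can be traded, at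
the price of a factor `δ`, for blocks that satisfy the term. -/
def Tradeable [Fintype κ] [DecidableEq κ] (μ : (κ → Option Bool) → ℝ) (δ : ℝ) (r : ℕ) : Prop :=
  ∀ z : κ → Option Bool, (univ.filter fun i => z i ≠ none).card ≤ r →
    ∀ g : (κ → Option Bool) → ℝ, (∀ x, 0 ≤ g x) → (∀ x y, Refines x y → g x ≤ g y) →
      ∑ x, μ x * (if ¬ Sat z x ∧ ¬ Fals z x then g x else 0) ≤
        δ * ∑ x, μ x * (if Sat z x then g x else 0)

end Local

variable {A κ : Type}

/-- The assignment to all variables in which the stars of the block `a` are replaced by `y a`. -/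
def fill (ρ : A → κ → Option Bool) (y : A → Bool) : A × κ → Bool :=
  fun b => (ρ b.1 b.2).getD (y b.1)

/-- The value of the DNF with the list `F` of terms. -/
def Holds (F : List (A → κ → Option Bool)) (x : A × κ → Bool) : Prop :=
  ∃ T ∈ F, ∀ a i b, T a i = some b → x (a, i) = b

/-- The term `T` is falsified by `ρ` and the answers `y` for the blocks in `Z`. -/
def Killed (T : A → κ → Option Bool) (Z : Finset A) (y : A → Bool) (ρ : A → κ → Option Bool) :
    Prop :=
  (∃ a ∈ Z, ¬ Answered (T a) (ρ a) (y a)) ∨ ∃ a, a ∉ Z ∧ Fals (T a) (ρ a)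

theorem Killed.congr {T : A → κ → Option Bool} {Z : Finset A} {y y' : A → Bool}
    {ρ : A → κ → Option Bool} (h : ∀ a ∈ Z, y' a = y a) : Killed T Z y' ρ ↔ Killed T Z y ρ := by
  unfold Killed
  refine or_congr_left ⟨?_, ?_⟩
  · rintro ⟨a, ha, h1⟩; exact ⟨a, ha, h a ha ▸ h1⟩
  · rintro ⟨a, ha, h1⟩; exact ⟨a, ha, (h a ha).symm ▸ h1⟩

variable [Fintype A] [DecidableEq A]

open Classical in
/-- The blocks outside `Z` that the term `T` still depends on. -/
noncomputable def openBlocks (T : A → κ → Option Bool) (Z : Finset A) (ρ : A → κ → Option Bool) :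
    Finset A :=
  univ.filter fun a => a ∉ Z ∧ ¬ Sat (T a) (ρ a)

open Classical in
/-- The blocks that the term `T` mentions. -/
noncomputable def activeBlocks (T : A → κ → Option Bool) : Finset A :=
  univ.filter fun a => T a ≠ fun _ => none

open Classical in
/-- The number of queries of the canonical decision tree of the DNF `F` on the branch given by `y`,
after the blocks in `Z` have been queried. -/
noncomputable def cnt : List (A → κ → Option Bool) → Finset A → (A → Bool) →
    (A → κ → Option Bool) → ℕ
  | [], _, _, _ => 0
  | T :: F, Z, y, ρ =>
    if Killed T Z y ρ then cnt F Z y ρ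
    else if openBlocks T Z ρ = ∅ then 0
    else (openBlocks T Z ρ).card + cnt F (Z ∪ openBlocks T Z ρ) y ρ

/-- Some branch that agrees with `y` on `Z` has at least `s` further queries. -/
def Deep (F : List (A → κ → Option Bool)) (Z : Finset A) (y : A → Bool) (s : ℕ)
    (ρ : A → κ → Option Bool) : Prop :=
  ∃ y', (∀ a ∈ Z, y' a = y a) ∧ s ≤ cnt F Z y' ρ

theorem exists_certificate (F : List (A → κ → Option Bool)) (ρ : A → κ → Option Bool)
    (y : A → Bool) (Z : Finset A) :
    ∃ Y : Finset A, Z ⊆ Y ∧ Y.card ≤ Z.card + cnt F Z y ρ ∧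
      ∀ y', (∀ a ∈ Y, y' a = y a) → (Holds F (fill ρ y') ↔ Holds F (fill ρ y)) := by
  classical
  induction F generalizing Z with
  | nil => exact ⟨Z, subset_rfl, by simp, fun y' _ => by simp [Holds]⟩
  | cons T F ih =>
    have hcons : ∀ y, Holds (T :: F) (fill ρ y) ↔
        (∀ a, Answered (T a) (ρ a) (y a)) ∨ Holds F (fill ρ y) := by
      intro y
      simp [Holds, Answered, fill]
    by_cases hK : Killed T Z y ρ
    · obtain ⟨Y, h1, h2, h3⟩ := ih Z
      refine ⟨Y, h1, by simpa [cnt, hK] using h2, fun y' hy' => ?_⟩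
      have hno : ∀ y'', Killed T Z y'' ρ → ¬ ∀ a, Answered (T a) (ρ a) (y'' a) := by
        rintro y'' (⟨a, _, h⟩ | ⟨a, _, h⟩) h'
        · exact h (h' a)
        · exact h.not_answered _ (h' a)
      rw [hcons, hcons, h3 y' hy']
      have h4 := hno y hK
      have h5 := hno y' ((Killed.congr fun a ha => hy' a (h1 ha)).2 hK)
      tauto
    · have key : ∀ y' : A → Bool, (∀ a ∈ Z ∪ openBlocks T Z ρ, y' a = y a) →
          ((∀ a, Answered (T a) (ρ a) (y' a)) ↔ ∀ a, Answered (T a) (ρ a) (y a)) := by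
        intro y' hy'
        refine forall_congr' fun a => ?_
        by_cases ha : a ∈ Z ∪ openBlocks T Z ρ
        · rw [hy' a ha]
        · have : Sat (T a) (ρ a) := by
            simp only [openBlocks, mem_union, mem_filter, mem_univ, true_and, not_or, not_and,
              not_not] at ha
            exact ha.2 ha.1
          exact iff_of_true (this.answered _) (this.answered _)
      by_cases hO : openBlocks T Z ρ = ∅
      · refine ⟨Z, subset_rfl, by simp, fun y' hy' => ?_⟩
        have hall : ∀ a, Answered (T a) (ρ a) (y a) := by
          intro a
          by_cases ha : a ∈ Z
          · by_contra h
            exact hK (Or.inl ⟨a, ha, h⟩)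
          · have h1 : a ∉ openBlocks T Z ρ := by simp [hO]
            simp only [openBlocks, mem_filter, mem_univ, true_and, not_and, not_not] at h1
            exact (h1 ha).answered _
        rw [hcons, hcons, key y' (by simpa [hO] using hy')]
        tauto
      · obtain ⟨Y, h1, h2, h3⟩ := ih (Z ∪ openBlocks T Z ρ)
        refine ⟨Y, subset_union_left.trans h1, ?_, fun y' hy' => ?_⟩
        · have := card_union_le Z (openBlocks T Z ρ)
          simp only [cnt, hK, hO, if_false]
          omega
        · rw [hcons, hcons, h3 y' hy', key y' fun a ha => hy' a (h1 ha)]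

/-- The term `T` is undetermined in exactly the blocks `B` and satisfied in the others. -/
def UndetIn (T : A → κ → Option Bool) (Z : Finset A) (y : A → Bool) (B : Finset A)
    (ρ : A → κ → Option Bool) : Prop :=
  (∀ a ∈ Z, Answered (T a) (ρ a) (y a)) ∧ (∀ a ∈ B, ¬ Sat (T a) (ρ a) ∧ ¬ Fals (T a) (ρ a)) ∧
    ∀ a, a ∉ Z → a ∉ B → Sat (T a) (ρ a)

/-- The answers `y`, changed on `B` to the indicator function of `P`. -/
def override (y : A → Bool) (B P : Finset A) : A → Bool :=
  fun a => if a ∈ B then decide (a ∈ P) else y a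

open Classical in
theorem deep_cons_le (T : A → κ → Option Bool) (F : List (A → κ → Option Bool)) (Z : Finset A)
    (y : A → Bool) (s : ℕ) (hs : 0 < s) {g : ℝ} (hg : 0 ≤ g) (ρ : A → κ → Option Bool) :
    (if Deep (T :: F) Z y s ρ then g else 0) ≤
      (if Deep F Z y s ρ then (if Killed T Z y ρ then g else 0) else 0) +
      ∑ B ∈ (activeBlocks T \ Z).powerset.erase ∅,
        ∑ P ∈ B.powerset, (if Deep F (Z ∪ B) (override y B P) (s - B.card) ρ then
          (if UndetIn T Z y B ρ then g else 0) else 0) := by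
  have hite : ∀ (a b : Prop), 0 ≤ (if a then (if b then g else 0) else 0) := fun a b => by
    split_ifs <;> simp [hg]
  have hsum : 0 ≤ ∑ B ∈ (activeBlocks T \ Z).powerset.erase ∅,
        ∑ P ∈ B.powerset, (if Deep F (Z ∪ B) (override y B P) (s - B.card) ρ then
          (if UndetIn T Z y B ρ then g else 0) else 0) :=
    sum_nonneg fun B _ => sum_nonneg fun P _ => hite _ _
  by_cases hD : Deep (T :: F) Z y s ρ
  swap
  · rw [if_neg hD]
    exact add_nonneg (hite _ _) hsum
  rw [if_pos hD]
  obtain ⟨y', hy', hc⟩ := hD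
  by_cases hK : Killed T Z y' ρ
  · have h1 : Deep F Z y s ρ := ⟨y', hy', by simpa [cnt, hK] using hc⟩
    rw [if_pos h1, if_pos ((Killed.congr hy').1 hK)]
    linarith
  · have hO : openBlocks T Z ρ ≠ ∅ := by
      intro hO
      simp [cnt, hK, hO] at hc
      omega
    simp only [cnt, hK, hO, if_false] at hc
    set B := openBlocks T Z ρ with hBdef
    have hBmem : ∀ a, a ∈ B ↔ a ∉ Z ∧ ¬ Sat (T a) (ρ a) := fun a => by simp [hBdef, openBlocks]
    have hBin : B ∈ (activeBlocks T \ Z).powerset.erase ∅ := by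
      refine mem_erase.2 ⟨hO, mem_powerset.2 fun a ha => ?_⟩
      rw [hBmem] at ha
      refine mem_sdiff.2 ⟨mem_filter.2 ⟨mem_univ _, fun h => ha.2 fun i b hi => ?_⟩, ha.1⟩
      simp [h] at hi
    have hU : UndetIn T Z y B ρ := by
      rw [Killed.congr hy'] at hK
      unfold Killed at hK
      push Not at hK
      refine ⟨fun a ha => hK.1 a ha, fun a ha => ?_, fun a ha ha' => ?_⟩
      · rw [hBmem] at ha
        exact ⟨ha.2, hK.2 a ha.1⟩
      · by_contra h
        exact ha' ((hBmem a).2 ⟨ha, h⟩)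
    have hdeep : Deep F (Z ∪ B) (override y B (B.filter fun a => y' a = true)) (s - B.card) ρ := by
      refine ⟨y', fun a ha => ?_, by omega⟩
      unfold override
      by_cases haB : a ∈ B
      · simp [haB]
      · rw [if_neg haB]
        exact hy' a ((mem_union.1 ha).resolve_right haB)
    have h1 := single_le_sum (f := fun P =>
        (if Deep F (Z ∪ B) (override y B P) (s - B.card) ρ then
          (if UndetIn T Z y B ρ then g else 0) else 0)) (fun P _ => hite _ _)
        (mem_powerset.2 (filter_subset (fun a => y' a = true) B))
    have h2 := single_le_sum (f := fun B => ∑ P ∈ B.powerset,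
        (if Deep F (Z ∪ B) (override y B P) (s - B.card) ρ then
          (if UndetIn T Z y B ρ then g else 0) else 0))
          (fun B _ => sum_nonneg fun P _ => hite _ _) hBin
    have h0 : g = if Deep F (Z ∪ B) (override y B (B.filter fun a => y' a = true)) (s - B.card) ρ
        then (if UndetIn T Z y B ρ then g else 0) else 0 := by
      rw [if_pos hdeep, if_pos hU]
    exact (h0.le.trans (h1.trans h2)).trans (le_add_of_nonneg_left (hite _ _))

variable [Fintype κ]

/-- The mass function of independent blocks. -/
noncomputable def blocks (μ : A → (κ → Option Bool) → ℝ) (ρ : A → κ → Option Bool) : ℝ :=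
  ∏ a, μ a (ρ a)

/-- `G` does not decrease if a block outside `Z` is refined. -/
def MonoOff (Z : Finset A) (G : (A → κ → Option Bool) → ℝ) : Prop :=
  ∀ ρ a x, a ∉ Z → Refines (ρ a) x → G ρ ≤ G (update ρ a x)

theorem sum_update [DecidableEq κ] (a : A) (f : (A → κ → Option Bool) → ℝ) :
    ∑ ρ, f ρ = ∑ ρ' : {j // j ≠ a} → κ → Option Bool, ∑ x,
      f (update (fun j => if h : j = a then fun _ => none else ρ' ⟨j, h⟩) a x) := by
  rw [← (Equiv.funSplitAt a (κ → Option Bool)).symm.sum_comp, Fintype.sum_prod_type, sum_comm]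
  refine sum_congr rfl fun ρ' _ => sum_congr rfl fun x _ => congrArg f ?_
  funext j
  by_cases h : j = a
  · subst h; simp [Equiv.funSplitAt, Equiv.piSplitAt]
  · simp [Equiv.funSplitAt, Equiv.piSplitAt, h]

variable [DecidableEq κ]

open Classical in
theorem trade_one {μ : A → (κ → Option Bool) → ℝ} (hμ : ∀ a x, 0 ≤ μ a x) {δ : ℝ} {r : ℕ} (a : A)
    (hB : Tradeable (μ a) δ r) {z : κ → Option Bool}
    (hz : (univ.filter fun i => z i ≠ none).card ≤ r) {G : (A → κ → Option Bool) → ℝ}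
    (hG : ∀ ρ, 0 ≤ G ρ) (hm : ∀ ρ x, Refines (ρ a) x → G ρ ≤ G (update ρ a x)) :
    ∑ ρ, blocks μ ρ * (if ¬ Sat z (ρ a) ∧ ¬ Fals z (ρ a) then G ρ else 0) ≤
      δ * ∑ ρ, blocks μ ρ * (if Sat z (ρ a) then G ρ else 0) := by
  rw [sum_update a, sum_update a, mul_sum]
  refine sum_le_sum fun ρ' _ => ?_
  set ρ₀ : A → κ → Option Bool := fun j => if h : j = a then fun _ => none else ρ' ⟨j, h⟩
  have hW : ∀ x, blocks μ (update ρ₀ a x) = μ a x * ∏ j ∈ univ.erase a, μ j (ρ₀ j) := by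
    intro x
    unfold blocks
    rw [← mul_prod_erase univ _ (mem_univ a), update_self]
    congr 1
    exact prod_congr rfl fun j hj => by rw [update_of_ne (ne_of_mem_erase hj)]
  have h := hB z hz (fun x => (∏ j ∈ univ.erase a, μ j (ρ₀ j)) * G (update ρ₀ a x))
    (fun x => mul_nonneg (prod_nonneg fun j _ => hμ _ _) (hG _)) (fun x y hxy =>
      mul_le_mul_of_nonneg_left (by
        have := hm (update ρ₀ a x) y (by simpa using hxy)
        simpa using this) (prod_nonneg fun j _ => hμ _ _))
  have hc : ∀ (E : Prop) [Decidable E] (u v g : ℝ), u * v * (if E then g else 0) = u * if E then v * g else 0 := by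
    intro E _ u v g
    split_ifs <;> ring
  simp only [hW, update_self, hc]
  exact h

open Classical in
theorem trade_many {μ : A → (κ → Option Bool) → ℝ} (hμ : ∀ a x, 0 ≤ μ a x) {δ : ℝ} (hδ : 0 ≤ δ)
    {r : ℕ} (hB : ∀ a, Tradeable (μ a) δ r) {T : A → κ → Option Bool}
    (hT : ∀ a, (univ.filter fun i => T a i ≠ none).card ≤ r) (Z : Finset A) (y : A → Bool)
    {G : (A → κ → Option Bool) → ℝ} (hG : ∀ ρ, 0 ≤ G ρ) (hm : MonoOff Z G)
    (B : Finset A) (hZB : ∀ a ∈ B, a ∉ Z) :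
    ∑ ρ, blocks μ ρ * (if UndetIn T Z y B ρ then G ρ else 0) ≤
      δ ^ B.card * ∑ ρ, blocks μ ρ * (if UndetIn T Z y ∅ ρ then G ρ else 0) := by
  induction B using Finset.induction_on with
  | empty => simp
  | insert a B ha ih =>
    have haZ : a ∉ Z := hZB a (mem_insert_self _ _)
    let R : (A → κ → Option Bool) → Prop := fun ρ =>
      (∀ a ∈ Z, Answered (T a) (ρ a) (y a)) ∧ (∀ a ∈ B, ¬ Sat (T a) (ρ a) ∧ ¬ Fals (T a) (ρ a)) ∧
        ∀ b, b ∉ Z → b ∉ B → b ≠ a → Sat (T b) (ρ b)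
    have hR : ∀ ρ x, R ρ → R (update ρ a x) := by
      rintro ρ x ⟨h1, h2, h3⟩
      refine ⟨fun b hb => ?_, fun b hb => ?_, fun b hb hb' hba => ?_⟩
      · rw [update_of_ne (by rintro rfl; exact haZ hb)]; exact h1 b hb
      · rw [update_of_ne (by rintro rfl; exact ha hb)]; exact h2 b hb
      · rw [update_of_ne hba]; exact h3 b hb hb' hba
    have h := trade_one hμ a (hB a) (hT a) (G := fun ρ => if R ρ then G ρ else 0)
      (fun ρ => by split_ifs <;> simp [hG]) (fun ρ x hx => by
        by_cases h : R ρ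
        · simp only [h, hR ρ x h, if_true]
          exact hm ρ a x haZ hx
        · simp only [h, if_false]
          split_ifs <;> simp [hG])
    have e1 : ∀ ρ, UndetIn T Z y (insert a B) ρ ↔
        (¬ Sat (T a) (ρ a) ∧ ¬ Fals (T a) (ρ a)) ∧ R ρ := by
      intro ρ
      simp only [UndetIn, R, mem_insert, forall_eq_or_imp, not_or]
      constructor
      · rintro ⟨h1, ⟨h2, h3⟩, h4⟩
        exact ⟨h2, h1, h3, fun b hb hb' hba => h4 b hb ⟨hba, hb'⟩⟩
      · rintro ⟨h2, h1, h3, h4⟩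
        exact ⟨h1, ⟨h2, h3⟩, fun b hb hb' => h4 b hb hb'.2 hb'.1⟩
    have e2 : ∀ ρ, UndetIn T Z y B ρ ↔ Sat (T a) (ρ a) ∧ R ρ := by
      intro ρ
      simp only [UndetIn, R]
      constructor
      · rintro ⟨h1, h2, h3⟩
        exact ⟨h3 a haZ ha, h1, h2, fun b hb hb' _ => h3 b hb hb'⟩
      · rintro ⟨h0, h1, h2, h3⟩
        refine ⟨h1, h2, fun b hb hb' => ?_⟩
        by_cases hba : b = a
        · exact hba ▸ h0
        · exact h3 b hb hb' hba
    simp only [e1, ite_and] at h ⊢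
    rw [card_insert_of_notMem ha, pow_succ', mul_assoc]
    refine h.trans (mul_le_mul_of_nonneg_left ?_ hδ)
    have := ih fun b hb => hZB b (mem_insert_of_mem hb)
    simpa only [e2, ite_and] using this

open Classical in
/-- The switching lemma for independent blocks, in the form needed for the induction. -/
theorem sum_deep_le {μ : A → (κ → Option Bool) → ℝ} (hμ : ∀ a x, 0 ≤ μ a x) {δ γ : ℝ} (hδ : 0 ≤ δ)
    (hγ0 : 0 < γ) (hγ1 : γ ≤ 1) {r : ℕ} (hr : (1 + 2 * δ / γ) ^ r ≤ 2)
    (hB : ∀ a, Tradeable (μ a) δ r) (F : List (A → κ → Option Bool))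
    (hF1 : ∀ T ∈ F, ∀ a, (univ.filter fun i => T a i ≠ none).card ≤ r)
    (hF2 : ∀ T ∈ F, (activeBlocks T).card ≤ r)
    (Z : Finset A) (y : A → Bool) (s : ℕ)
    {G : (A → κ → Option Bool) → ℝ} (hG : ∀ ρ, 0 ≤ G ρ) (hm : MonoOff Z G) :
    ∑ ρ, blocks μ ρ * (if Deep F Z y s ρ then G ρ else 0) ≤ γ ^ s * ∑ ρ, blocks μ ρ * G ρ := by
  have hW : ∀ ρ, 0 ≤ blocks μ ρ := fun ρ => prod_nonneg fun a _ => hμ _ _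
  rcases Nat.eq_zero_or_pos s with rfl | hs
  · rw [pow_zero, one_mul]
    refine sum_le_sum fun ρ _ => mul_le_mul_of_nonneg_left ?_ (hW ρ)
    split_ifs <;> simp [hG]
  induction F generalizing Z y s G with
  | nil =>
    have : ∀ ρ, ¬ Deep ([] : List (A → κ → Option Bool)) Z y s ρ := by
      rintro ρ ⟨y', _, h⟩
      simp [cnt] at h
      omega
    simp only [this, if_false, mul_zero, sum_const_zero]
    exact mul_nonneg (by positivity) (sum_nonneg fun ρ _ => mul_nonneg (hW ρ) (hG ρ))
  | cons T F ih =>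
    replace ih : ∀ (Z : Finset A) (y : A → Bool) (s : ℕ) (G : (A → κ → Option Bool) → ℝ),
        (∀ ρ, 0 ≤ G ρ) → MonoOff Z G →
        ∑ ρ, blocks μ ρ * (if Deep F Z y s ρ then G ρ else 0) ≤
          γ ^ s * ∑ ρ, blocks μ ρ * G ρ := by
      intro Z y s G hG hm
      rcases Nat.eq_zero_or_pos s with rfl | hs
      · rw [pow_zero, one_mul]
        refine sum_le_sum fun ρ _ => mul_le_mul_of_nonneg_left ?_ (hW ρ)
        split_ifs <;> simp [hG]
      · exact ih (fun T hT => hF1 T (List.mem_cons_of_mem _ hT))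
          (fun T hT => hF2 T (List.mem_cons_of_mem _ hT)) Z y s hG hm hs
    have hT1 := hF1 T List.mem_cons_self
    have hT2 := hF2 T List.mem_cons_self
    set S := activeBlocks T \ Z with hS
    have hite : ∀ (E : (A → κ → Option Bool) → Prop) ρ, 0 ≤ (if E ρ then G ρ else 0) :=
      fun E ρ => by split_ifs <;> simp [hG]
    have hK : ∑ ρ, blocks μ ρ * (if Deep F Z y s ρ then (if Killed T Z y ρ then G ρ else 0) else 0)
        ≤ γ ^ s * ∑ ρ, blocks μ ρ * (if Killed T Z y ρ then G ρ else 0) := by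
      refine ih Z y s _ (hite _) fun ρ a x ha hx => ?_
      by_cases h : Killed T Z y ρ
      · have h' : Killed T Z y (update ρ a x) := by
          rcases h with ⟨b, hb, h⟩ | ⟨b, hb, h⟩
          · refine Or.inl ⟨b, hb, ?_⟩
            rwa [update_of_ne (by rintro rfl; exact ha hb)]
          · refine Or.inr ⟨b, hb, ?_⟩
            by_cases hba : b = a
            · subst hba; rw [update_self]; exact h.mono hx
            · rwa [update_of_ne hba]
        simp only [h, h', if_true]
        exact hm ρ a x ha hx
      · rw [if_neg h]
        exact hite _ _
    set M := ∑ ρ, blocks μ ρ * (if UndetIn T Z y ∅ ρ then G ρ else 0) with hM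
    have hM0 : 0 ≤ M := sum_nonneg fun ρ _ => mul_nonneg (hW ρ) (hite _ ρ)
    have hU : ∀ B ∈ S.powerset.erase ∅, ∀ P,
        ∑ ρ, blocks μ ρ * (if Deep F (Z ∪ B) (override y B P) (s - B.card) ρ then
          (if UndetIn T Z y B ρ then G ρ else 0) else 0) ≤
          γ ^ (s - B.card) * δ ^ B.card * M := by
      intro B hBS P
      have hBZ : ∀ a ∈ B, a ∉ Z := fun a ha =>
        (mem_sdiff.1 (mem_powerset.1 (mem_of_mem_erase hBS) ha)).2
      rw [mul_assoc]
      refine (ih (Z ∪ B) (override y B P) (s - B.card) _ (hite _) fun ρ a x ha hx => ?_).trans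
        (mul_le_mul_of_nonneg_left (trade_many hμ hδ hB hT1 Z y hG hm B hBZ) (by positivity))
      have haZ : a ∉ Z := fun h => ha (mem_union_left _ h)
      have haB : a ∉ B := fun h => ha (mem_union_right _ h)
      by_cases h : UndetIn T Z y B ρ
      · have h' : UndetIn T Z y B (update ρ a x) := by
          obtain ⟨h1, h2, h3⟩ := h
          refine ⟨fun b hb => ?_, fun b hb => ?_, fun b hb hb' => ?_⟩
          · rw [update_of_ne (by rintro rfl; exact haZ hb)]; exact h1 b hb
          · rw [update_of_ne (by rintro rfl; exact haB hb)]; exact h2 b hb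
          · by_cases hba : b = a
            · subst hba; rw [update_self]; exact (h3 b hb hb').mono hx
            · rw [update_of_ne hba]; exact h3 b hb hb'
        simp only [h, h', if_true]
        exact hm ρ a x haZ hx
      · rw [if_neg h]
        exact hite _ _
    have hKM : ∑ ρ, blocks μ ρ * (if Killed T Z y ρ then G ρ else 0) + M ≤
        ∑ ρ, blocks μ ρ * G ρ := by
      rw [hM, ← sum_add_distrib]
      refine sum_le_sum fun ρ _ => ?_
      rw [← mul_add]
      refine mul_le_mul_of_nonneg_left ?_ (hW ρ)
      by_cases h : Killed T Z y ρ
      · have h' : ¬ UndetIn T Z y ∅ ρ := by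
          rintro ⟨h1, _, h3⟩
          rcases h with ⟨b, hb, h⟩ | ⟨b, hb, h⟩
          · exact h (h1 b hb)
          · exact (h3 b hb (notMem_empty b)).not_fals h
        simp [h, h']
      · rw [if_neg h]
        split_ifs <;> simp [hG]
    calc ∑ ρ, blocks μ ρ * (if Deep (T :: F) Z y s ρ then G ρ else 0)
        ≤ ∑ ρ, blocks μ ρ * ((if Deep F Z y s ρ then (if Killed T Z y ρ then G ρ else 0) else 0) +
          ∑ B ∈ S.powerset.erase ∅,
            ∑ P ∈ B.powerset, (if Deep F (Z ∪ B) (override y B P) (s - B.card) ρ then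
              (if UndetIn T Z y B ρ then G ρ else 0) else 0)) :=
          sum_le_sum fun ρ _ => mul_le_mul_of_nonneg_left
            (deep_cons_le T F Z y s hs (hG ρ) ρ) (hW ρ)
      _ = ∑ ρ, blocks μ ρ * (if Deep F Z y s ρ then (if Killed T Z y ρ then G ρ else 0) else 0) +
          ∑ B ∈ S.powerset.erase ∅, ∑ P ∈ B.powerset, ∑ ρ, blocks μ ρ *
            (if Deep F (Z ∪ B) (override y B P) (s - B.card) ρ then
              (if UndetIn T Z y B ρ then G ρ else 0) else 0) := by
          simp only [mul_add, sum_add_distrib, mul_sum]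
          congr 1
          rw [sum_comm]
          exact sum_congr rfl fun B _ => sum_comm
      _ ≤ γ ^ s * ∑ ρ, blocks μ ρ * (if Killed T Z y ρ then G ρ else 0) +
          ∑ B ∈ S.powerset.erase ∅, ∑ P ∈ B.powerset, γ ^ (s - B.card) * δ ^ B.card * M :=
          add_le_add hK (sum_le_sum fun B hBS => sum_le_sum fun P _ => hU B hBS P)
      _ = γ ^ s * ∑ ρ, blocks μ ρ * (if Killed T Z y ρ then G ρ else 0) +
          (∑ B ∈ S.powerset.erase ∅, (2 : ℝ) ^ B.card * (γ ^ (s - B.card) * δ ^ B.card)) * M := by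
          rw [sum_mul]
          congr 1
          refine sum_congr rfl fun B _ => ?_
          rw [sum_const, card_powerset, nsmul_eq_mul]
          push_cast
          ring
      _ ≤ γ ^ s * ∑ ρ, blocks μ ρ * (if Killed T Z y ρ then G ρ else 0) + γ ^ s * M :=
          add_le_add le_rfl (mul_le_mul_of_nonneg_right (sum_powerset_erase_le S
            ((card_le_card sdiff_subset).trans hT2) hδ hγ0 hγ1 hr s) hM0)
      _ ≤ γ ^ s * ∑ ρ, blocks μ ρ * G ρ := by
          rw [← mul_add]
          exact mul_le_mul_of_nonneg_left hKM (by positivity)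

end Switching

theorem CertLE.comp {U V : Type} {f : (V → Bool) → Bool} {s : ℕ} (hf : CertLE f s)
    {E : (U → Bool) → V → Bool} (hE : ∀ v, CertLE (fun y => E y v) 1) :
    CertLE (fun y => f (E y)) s := by
  classical
  intro y
  obtain ⟨Y, hY, h⟩ := hf (E y)
  choose c hc1 hc2 using fun v => hE v y
  refine ⟨Y.biUnion c, ?_, fun y' hy' => h _ fun v hv => hc2 v y' fun u hu =>
    hy' u (Finset.mem_biUnion.2 ⟨v, hv, hu⟩)⟩
  calc (Y.biUnion c).card ≤ ∑ v ∈ Y, (c v).card := Finset.card_biUnion_le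
    _ ≤ ∑ v ∈ Y, 1 := Finset.sum_le_sum fun v _ => hc1 v
    _ ≤ s := by simpa using hY

theorem CertLE.mono {V : Type} {f : (V → Bool) → Bool} {s s' : ℕ} (hf : CertLE f s)
    (h : s ≤ s') : CertLE f s' := by
  intro y
  obtain ⟨Y, hY, h'⟩ := hf y
  exact ⟨Y, hY.trans h, h'⟩

theorem certLE_not {V : Type} {f : (V → Bool) → Bool} {s : ℕ} :
    CertLE (fun x => !f x) s ↔ CertLE f s := by
  simp [CertLE]

theorem CertLE.of_eval {V : Type} (v : V) : CertLE (fun y : V → Bool => y v) 1 :=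
  fun _ => ⟨{v}, by simp, fun _ h => h v (by simp)⟩

theorem certLE_const {V : Type} (b : Bool) (s : ℕ) : CertLE (fun _ : V → Bool => b) s :=
  fun _ => ⟨∅, by simp, fun _ _ => rfl⟩

theorem CertLE.beq {V : Type} {f : (V → Bool) → Bool} {s : ℕ} (hf : CertLE f s) (b : Bool) :
    CertLE (fun x => f x == b) s := by
  intro y
  obtain ⟨Y, hY, h⟩ := hf y
  exact ⟨Y, hY, fun y' hy' => by simp only [h y' hy']⟩

/-! Probabilities -/

theorem massProb_mono {α : Type} [Fintype α] {f : α → ℝ} (hf : ∀ a, 0 ≤ f a) {E E' : α → Prop}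
    (h : ∀ a, E a → E' a) : massProb f E ≤ massProb f E' := by
  unfold massProb
  refine Finset.sum_le_sum fun a _ => ?_
  by_cases hE : E a
  · simp [hE, h a hE]
  · rw [if_neg hE]
    split_ifs <;> simp [hf]

theorem massProb_exists_le {α β : Type} [Fintype α] [Fintype β] {f : α → ℝ} (hf : ∀ a, 0 ≤ f a)
    (E : β → α → Prop) : massProb f (fun a => ∃ b, E b a) ≤ ∑ b, massProb f (E b) := by
  unfold massProb
  rw [Finset.sum_comm]
  refine Finset.sum_le_sum fun a _ => ?_
  have h0 : ∀ b, 0 ≤ (open Classical in if E b a then f a else 0) := fun b => by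
    split_ifs <;> simp [hf]
  split_ifs with h
  · obtain ⟨b, hb⟩ := h
    have := Finset.single_le_sum (fun b _ => h0 b) (Finset.mem_univ b)
    simpa [hb] using this
  · exact Finset.sum_nonneg fun b _ => h0 b

theorem massProb_not {α : Type} [Fintype α] {f : α → ℝ} (hf : IsProbMass f) (E : α → Prop) :
    massProb f E = 1 - massProb f fun a => ¬ E a := by
  rw [eq_sub_iff_add_eq, ← hf.2]
  unfold massProb
  rw [← Finset.sum_add_distrib]
  refine Finset.sum_congr rfl fun a _ => ?_
  by_cases h : E a <;> simp [h]

namespace Switching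

open Finset

variable {A κ : Type} [Fintype A] [DecidableEq A] [Fintype κ] [DecidableEq κ]

theorem isProbMass_blocks {μ : A → (κ → Option Bool) → ℝ} (hμ : ∀ a, IsProbMass (μ a)) :
    IsProbMass (blocks μ) := by
  refine ⟨fun ρ => prod_nonneg fun a _ => (hμ a).1 _, ?_⟩
  unfold blocks
  have := prod_univ_sum (fun _ : A => (univ : Finset (κ → Option Bool))) fun a x => μ a x
  rw [Fintype.piFinset_univ] at this
  rw [← this]
  simp [(hμ _).2]

theorem exists_terms {g : (A × κ → Bool) → Bool} {r : ℕ}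
    (hg : ∀ x, g x = true → ∃ Y : Finset (A × κ), Y.card ≤ r ∧
      ∀ x', (∀ v ∈ Y, x' v = x v) → g x' = true) :
    ∃ F : List (A → κ → Option Bool),
      (∀ T ∈ F, ∀ a, (univ.filter fun i => T a i ≠ none).card ≤ r) ∧
      (∀ T ∈ F, (activeBlocks T).card ≤ r) ∧ ∀ x, Holds F x ↔ g x = true := by
  classical
  let good : (A → κ → Option Bool) → Prop := fun T =>
    (univ.filter fun b : A × κ => T b.1 b.2 ≠ none).card ≤ r ∧
      ∀ x : A × κ → Bool, (∀ a i b, T a i = some b → x (a, i) = b) → g x = true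
  refine ⟨(univ.filter good).toList, fun T hT a => ?_, fun T hT => ?_, fun x => ⟨?_, fun hx => ?_⟩⟩
  · have h : good T := by simpa using hT
    refine le_trans ?_ h.1
    refine card_le_card_of_injOn (fun i => (a, i)) (fun i hi => ?_) fun i _ j _ hij => by simpa using hij
    simpa using hi
  · have h : good T := by simpa using hT
    refine le_trans ?_ h.1
    refine le_trans (card_le_card (t := (univ.filter fun b : A × κ => T b.1 b.2 ≠ none).image
      Prod.fst) fun a ha => ?_) card_image_le
    simp only [activeBlocks, mem_filter, mem_univ, true_and] at ha
    obtain ⟨i, hi⟩ := Function.ne_iff.1 ha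
    exact mem_image.2 ⟨(a, i), by simpa using hi, rfl⟩
  · rintro ⟨T, hT, h⟩
    have h' : good T := by simpa using hT
    exact h'.2 x h
  · obtain ⟨Y, hY, h⟩ := hg x hx
    refine ⟨fun a i => if (a, i) ∈ Y then some (x (a, i)) else none, ?_, ?_⟩
    · rw [mem_toList, mem_filter]
      refine ⟨mem_univ _, ?_, fun x' hx' => h x' fun v hv => ?_⟩
      · simpa using hY
      · exact hx' v.1 v.2 (x v) (by simp [hv])
    · intro a i b hb
      simp only [Option.ite_none_right_eq_some, Option.some.injEq] at hb
      exact hb.2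

/-- The switching lemma for projections: a DNF of width `r` turns into a function with certificates
of size `s`, except with probability `γ ^ (s + 1)`. -/
theorem massProb_not_certLE_le {μ : A → (κ → Option Bool) → ℝ} (hμ : ∀ a, IsProbMass (μ a))
    {δ γ : ℝ} (hδ : 0 ≤ δ) (hγ0 : 0 < γ) (hγ1 : γ ≤ 1) {r : ℕ} (hr : (1 + 2 * δ / γ) ^ r ≤ 2)
    (hB : ∀ a, Tradeable (μ a) δ r) {g : (A × κ → Bool) → Bool}
    (hg : ∀ x, g x = true → ∃ Y : Finset (A × κ), Y.card ≤ r ∧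
      ∀ x', (∀ v ∈ Y, x' v = x v) → g x' = true) (s : ℕ) :
    massProb (blocks μ) (fun ρ => ¬ CertLE (fun y => g (fill ρ y)) s) ≤ γ ^ (s + 1) := by
  classical
  obtain ⟨F, hF1, hF2, hF⟩ := exists_terms hg
  have h := sum_deep_le (fun a => (hμ a).1) hδ hγ0 hγ1 hr hB F hF1 hF2 ∅ (fun _ => true) (s + 1)
    (G := fun _ => 1) (fun _ => zero_le_one) (fun _ _ _ _ _ => le_rfl)
  have hp := isProbMass_blocks hμ
  simp only [mul_one, hp.2] at h
  refine le_trans (massProb_mono hp.1 (E' := fun ρ => Deep F ∅ (fun _ => true) (s + 1) ρ) ?_)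
    (le_trans (le_of_eq ?_) h)
  · intro ρ hρ
    by_contra hD
    refine hρ fun y => ?_
    obtain ⟨Y, -, hY, hY'⟩ := exists_certificate F ρ y ∅
    refine ⟨Y, ?_, fun y' hy' => ?_⟩
    · by_contra hs
      refine hD ⟨y, by simp, ?_⟩
      simp at hY
      omega
    · have := hY' y' hy'
      rw [hF, hF] at this
      exact Bool.eq_iff_iff.2 this
  · unfold massProb
    refine sum_congr rfl fun ρ _ => ?_
    by_cases hD : Deep F ∅ (fun _ => true) (s + 1) ρ <;> simp [hD]

end Switching

/-! Gates and normal forms -/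

/-- A conjunction of functions with certificates of size `s` is a CNF of width `s`. -/
theorem exists_cnf {V : Type} [Fintype V] [DecidableEq V] {g : (V → Bool) → Bool} {s : ℕ}
    (hg : ∀ x, g x = false → ∃ Y : Finset V, Y.card ≤ s ∧
      ∀ x', (∀ v ∈ Y, x' v = x v) → g x' = false) :
    ∃ F : NormalForm V, F.width ≤ s ∧ F.evalCNF = g := by
  classical
  refine ⟨Finset.univ.filter fun c => (c.image Prod.fst).card ≤ s ∧
    ∀ x, g x = true → ∃ l ∈ c, BoolLit.val x l = true, ?_, ?_⟩
  · refine Finset.sup_le fun c hc => ?_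
    exact (Finset.mem_filter.1 hc).2.1
  · funext x
    rw [Bool.eq_iff_iff]
    simp only [NormalForm.evalCNF, decide_eq_true_eq, Finset.mem_filter, Finset.mem_univ, true_and]
    refine ⟨fun h => ?_, fun h c hc => hc.2 x h⟩
    by_contra hx
    obtain ⟨Y, hY, hY'⟩ := hg x (by simpa using hx)
    obtain ⟨l, hl, hl'⟩ := h (Y.image fun v => (v, !x v)) ⟨by
      rw [Finset.image_image]
      exact Finset.card_image_le.trans hY, fun x' hx' => by
        by_contra hno
        push Not at hno
        have := hY' x' fun v hv => by
          have := hno (v, !x v) (Finset.mem_image_of_mem _ hv)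
          simpa [BoolLit.val] using this
        simp [this] at hx'⟩
    obtain ⟨v, hv, rfl⟩ := Finset.mem_image.1 hl
    simp [BoolLit.val] at hl'

theorem exists_dnf {V : Type} [Fintype V] [DecidableEq V] {g : (V → Bool) → Bool} {s : ℕ}
    (hg : ∀ x, g x = true → ∃ Y : Finset V, Y.card ≤ s ∧
      ∀ x', (∀ v ∈ Y, x' v = x v) → g x' = true) :
    ∃ F : NormalForm V, F.width ≤ s ∧ F.evalDNF = g := by
  classical
  refine ⟨Finset.univ.filter fun c => (c.image Prod.fst).card ≤ s ∧
    ∀ x, (∀ l ∈ c, BoolLit.val x l = true) → g x = true, ?_, ?_⟩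
  · refine Finset.sup_le fun c hc => ?_
    exact (Finset.mem_filter.1 hc).2.1
  · funext x
    rw [Bool.eq_iff_iff]
    simp only [NormalForm.evalDNF, decide_eq_true_eq, Finset.mem_filter, Finset.mem_univ, true_and]
    refine ⟨fun ⟨c, hc, h⟩ => hc.2 x h, fun h => ?_⟩
    obtain ⟨Y, hY, hY'⟩ := hg x h
    refine ⟨Y.image fun v => (v, x v), ⟨?_, fun x' hx' => hY' x' fun v hv => ?_⟩, ?_⟩
    · rw [Finset.image_image]
      exact Finset.card_image_le.trans hY
    · simpa [BoolLit.val] using hx' (v, x v) (Finset.mem_image_of_mem _ hv)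
    · intro l hl
      obtain ⟨v, hv, rfl⟩ := Finset.mem_image.1 hl
      simp [BoolLit.val]

namespace BoolCircuit

variable {V : Type}

/-- An `OR` gate whose inputs have small certificates has small certificates for the value `1`. -/
theorem gateVal_or {U : Type} (C : BoolCircuit V) (E : (U → Bool) → V → Bool) {r : ℕ}
    (g : Fin C.size) (hg : C.isAnd g = false)
    (hl : ∀ l ∈ C.lits g, CertLE (fun y => BoolLit.val (E y) l) r)
    (hh : ∀ h ∈ C.inputs g, CertLE (fun y => C.gateVal (E y) h) r) (x : U → Bool)
    (hx : C.gateVal (E x) g = true) :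
    ∃ Y : Finset U, Y.card ≤ r ∧ ∀ x', (∀ v ∈ Y, x' v = x v) → C.gateVal (E x') g = true := by
  rw [gateVal] at hx
  simp only [hg, Bool.false_eq_true, if_false, decide_eq_true_eq] at hx
  rcases hx with ⟨l, hlg, hlx⟩ | ⟨h, hhx⟩
  · obtain ⟨Y, hY, hY'⟩ := hl l hlg x
    refine ⟨Y, hY, fun x' hx' => ?_⟩
    rw [gateVal]
    simp only [hg, Bool.false_eq_true, if_false, decide_eq_true_eq]
    exact Or.inl ⟨l, hlg, (hY' x' hx').trans hlx⟩
  · obtain ⟨Y, hY, hY'⟩ := hh h.1 h.2 x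
    refine ⟨Y, hY, fun x' hx' => ?_⟩
    rw [gateVal]
    simp only [hg, Bool.false_eq_true, if_false, decide_eq_true_eq]
    exact Or.inr ⟨h, (hY' x' hx').trans hhx⟩

/-- An `AND` gate whose inputs have small certificates has small certificates for the value `0`. -/
theorem gateVal_and {U : Type} (C : BoolCircuit V) (E : (U → Bool) → V → Bool) {r : ℕ}
    (g : Fin C.size) (hg : C.isAnd g = true)
    (hl : ∀ l ∈ C.lits g, CertLE (fun y => BoolLit.val (E y) l) r)
    (hh : ∀ h ∈ C.inputs g, CertLE (fun y => C.gateVal (E y) h) r) (x : U → Bool)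
    (hx : C.gateVal (E x) g = false) :
    ∃ Y : Finset U, Y.card ≤ r ∧ ∀ x', (∀ v ∈ Y, x' v = x v) → C.gateVal (E x') g = false := by
  rw [gateVal] at hx
  simp only [hg, if_true, decide_eq_false_iff_not, not_and_or, not_forall] at hx
  rcases hx with ⟨l, hlg, hlx⟩ | ⟨h, hhx⟩
  · obtain ⟨Y, hY, hY'⟩ := hl l hlg x
    refine ⟨Y, hY, fun x' hx' => ?_⟩
    rw [gateVal]
    simp only [hg, if_true, decide_eq_false_iff_not, not_and_or, not_forall]
    exact Or.inl ⟨l, hlg, fun h => hlx ((hY' x' hx').symm.trans h)⟩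
  · obtain ⟨Y, hY, hY'⟩ := hh h.1 h.2 x
    refine ⟨Y, hY, fun x' hx' => ?_⟩
    rw [gateVal]
    simp only [hg, if_true, decide_eq_false_iff_not, not_and_or, not_forall]
    exact Or.inr ⟨h, fun h' => hhx ((hY' x' hx').symm.trans h')⟩

end BoolCircuit

/-! The mixtures on a block -/

namespace Switching

open Finset
open SipserProj (mixMass)

section Weight

variable {ι : Type} [Fintype ι]

/-- The probability of a set in which all elements occur independently with probability `t`. -/
noncomputable def setWeight (t : ℝ) (U : Finset ι) : ℝ :=
  t ^ U.card * (1 - t) ^ (Fintype.card ι - U.card)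

theorem setWeight_nonneg {t : ℝ} (h0 : 0 ≤ t) (h1 : t ≤ 1) (U : Finset ι) : 0 ≤ setWeight t U :=
  mul_nonneg (pow_nonneg h0 _) (pow_nonneg (by linarith) _)

theorem sum_setWeight (t : ℝ) : ∑ U : Finset ι, setWeight t U = 1 := by
  have := Finset.sum_pow_mul_eq_add_pow t (1 - t) (univ : Finset ι)
  rw [powerset_univ, card_univ] at this
  unfold setWeight
  rw [this]
  simp

theorem setWeight_empty (t : ℝ) : setWeight t (∅ : Finset ι) = (1 - t) ^ Fintype.card ι := by
  simp [setWeight]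

end Weight

section Mixture

variable {ι : Type} [DecidableEq ι]

/-- The string with the symbol `o` on `U` and `some c` elsewhere. -/
def mark (o : Option Bool) (c : Bool) (U : Finset ι) : ι → Option Bool :=
  fun i => if i ∈ U then o else some c

theorem mark_injective {o : Option Bool} {c : Bool} (ho : o ≠ some c) :
    Function.Injective (mark (ι := ι) o c) := by
  intro U U' h
  ext i
  have := congrFun h i
  by_cases h1 : i ∈ U <;> by_cases h2 : i ∈ U' <;> simp_all [mark]

theorem mark_empty (o : Option Bool) (c : Bool) : mark (ι := ι) o c ∅ = fun _ => some c := by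
  funext i; simp [mark]

variable [Fintype ι]

theorem sum_setWeight_erase (t : ℝ) :
    ∑ U ∈ univ.erase (∅ : Finset ι), setWeight t U = 1 - (1 - t) ^ Fintype.card ι := by
  rw [← setWeight_empty, ← sum_setWeight (ι := ι) t, ← add_sum_erase univ _ (mem_univ ∅)]
  ring

theorem productMass_mark {o : Option Bool} {c : Bool} (ho : o ≠ some c) (t : ℝ) (U : Finset ι) :
    productMass (twoPoint o t (some c)) (mark o c U) = setWeight t U := by
  unfold productMass setWeight mark
  have : ∀ i, twoPoint o t (some c) (if i ∈ U then o else some c) =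
      if i ∈ U then t else 1 - t := by
    intro i
    split_ifs <;> simp [twoPoint, ho.symm]
  simp only [this]
  rw [prod_ite, prod_const, prod_const]
  congr 2
  · congr 1; ext; simp
  · rw [← card_compl]; congr 1; ext; simp

theorem productMass_eq_zero {o : Option Bool} {c : Bool} (t : ℝ) {x : ι → Option Bool}
    (hx : x ∉ Set.range (mark o c)) : productMass (twoPoint o t (some c)) x = 0 := by
  by_contra h
  refine hx ⟨univ.filter fun i => x i = o, ?_⟩
  funext i
  unfold productMass at h
  have hi := prod_ne_zero_iff.1 h i (mem_univ i)
  by_cases h1 : x i = o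
  · simp [mark, h1]
  · by_cases h2 : x i = some c
    · rw [mark, if_neg (by simpa using h1), h2]
    · simp [twoPoint, h1, h2] at hi

theorem sum_productMass {o : Option Bool} {c : Bool} (ho : o ≠ some c) (t : ℝ)
    (f : (ι → Option Bool) → ℝ) :
    ∑ x, productMass (twoPoint o t (some c)) x * f x = ∑ U, setWeight t U * f (mark o c U) := by
  symm
  refine sum_of_injOn (mark o c) (mark_injective ho).injOn (by simp) (fun x _ hx => ?_)
    fun U _ => by rw [productMass_mark ho]
  rw [productMass_eq_zero t (by simpa using hx), zero_mul]

theorem productMass_const {o : Option Bool} {c : Bool} (ho : o ≠ some c) (t : ℝ) :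
    productMass (twoPoint o t (some c)) (fun _ : ι => some c) = (1 - t) ^ Fintype.card ι := by
  rw [← mark_empty o c, productMass_mark ho, setWeight_empty]

theorem sum_condNe {o : Option Bool} {c : Bool} (ho : o ≠ some c) (t : ℝ)
    (f : (ι → Option Bool) → ℝ) :
    ∑ x, condNe (productMass (twoPoint o t (some c))) (fun _ => some c) x * f x =
      (∑ U ∈ univ.erase ∅, setWeight t U * f (mark o c U)) / (1 - (1 - t) ^ Fintype.card ι) := by
  have h := sum_productMass ho t fun x =>
    (if x = fun _ => some c then 0 else f x) / (1 - (1 - t) ^ Fintype.card ι)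
  have h1 : ∀ x, condNe (productMass (twoPoint o t (some c))) (fun _ => some c) x * f x =
      productMass (twoPoint o t (some c)) x *
        ((if x = fun _ => some c then 0 else f x) / (1 - (1 - t) ^ Fintype.card ι)) := by
    intro x
    unfold condNe
    rw [productMass_const ho]
    split_ifs <;> ring
  rw [sum_congr rfl fun x _ => h1 x, h, ← add_sum_erase univ _ (mem_univ ∅), sum_div]
  rw [if_pos (mark_empty o c), zero_div, mul_zero, zero_add]
  refine sum_congr rfl fun U hU => ?_
  rw [if_neg, mul_div_assoc]
  rw [← mark_empty o c]
  exact fun h' => ne_of_mem_erase hU (mark_injective ho h')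

theorem sum_mixMass (c : Bool) (t l Q : ℝ) (f : (ι → Option Bool) → ℝ) :
    ∑ x, mixMass c t l Q x * f x = l * f (fun _ => some c) +
      Q * ((∑ U ∈ univ.erase ∅, setWeight t U * f (mark none c U)) /
        (1 - (1 - t) ^ Fintype.card ι)) +
      (1 - l - Q) * ((∑ U ∈ univ.erase ∅, setWeight t U * f (mark (some !c) c U)) /
        (1 - (1 - t) ^ Fintype.card ι)) := by
  rw [← sum_condNe (by simp), ← sum_condNe (by simp)]
  unfold mixMass
  simp only [add_mul, sum_add_distrib, mul_sum]
  congr 1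
  · congr 1
    · rw [sum_eq_single (fun _ => some c)]
      · simp
      · intro x _ hx; simp [hx]
      · simp
    · simp only [mul_assoc]
  · simp only [mul_assoc]

theorem twoPoint_nonneg {α : Type} [DecidableEq α] (u v : α) {t : ℝ} (h0 : 0 ≤ t) (h1 : t ≤ 1)
    (x : α) : 0 ≤ twoPoint u t v x := by
  unfold twoPoint
  split_ifs <;> linarith

theorem isProbMass_productMass {o : Option Bool} {c : Bool} (ho : o ≠ some c) {t : ℝ}
    (h0 : 0 ≤ t) (h1 : t ≤ 1) : IsProbMass (productMass (ι := ι) (twoPoint o t (some c))) := by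
  refine ⟨fun x => prod_nonneg fun i _ => twoPoint_nonneg _ _ h0 h1 _, ?_⟩
  simpa [sum_setWeight] using sum_productMass (ι := ι) ho t fun _ => 1

theorem condNe_nonneg {o : Option Bool} {c : Bool} (ho : o ≠ some c) {t : ℝ}
    (h0 : 0 ≤ t) (h1 : t ≤ 1) (x : ι → Option Bool) :
    0 ≤ condNe (productMass (twoPoint o t (some c))) (fun _ => some c) x := by
  unfold condNe
  split_ifs
  · exact le_rfl
  · rw [productMass_const ho]
    refine div_nonneg (prod_nonneg fun i _ => twoPoint_nonneg _ _ h0 h1 _) ?_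
    have := pow_le_one₀ (n := Fintype.card ι) (by linarith : 0 ≤ 1 - t) (by linarith)
    linarith

theorem isProbMass_mixMass {c : Bool} {t l Q : ℝ} (h0 : 0 ≤ t) (h1 : t ≤ 1)
    (hn : (1 - t) ^ Fintype.card ι < 1) (hl : 0 ≤ l) (hQ : 0 ≤ Q) (hlQ : l + Q ≤ 1) :
    IsProbMass (mixMass (ι := ι) c t l Q) := by
  refine ⟨fun x => ?_, ?_⟩
  · unfold mixMass
    have h2 := condNe_nonneg (ι := ι) (o := none) (c := c) (by simp) h0 h1 x
    have h3 := condNe_nonneg (ι := ι) (o := some !c) (c := c) (by simp) h0 h1 x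
    refine add_nonneg (add_nonneg (mul_nonneg hl ?_) (mul_nonneg hQ h2))
      (mul_nonneg (by linarith) h3)
    split_ifs <;> norm_num
  · have h := sum_mixMass (ι := ι) c t l Q fun _ => 1
    simp only [mul_one, sum_setWeight_erase] at h
    rw [h, div_self (by linarith)]
    ring

/-- Summing over the part of a random set in a small set `D`. -/
theorem sum_setWeight_sdiff_le {t : ℝ} (h0 : 0 ≤ t) (h1 : t < 1) (D : Finset ι) {r : ℕ}
    (hD : D.card ≤ r) (h : Finset ι → ℝ) (hh : ∀ W, 0 ≤ h W) :
    ∑ U, setWeight t U * h (U \ D) ≤ (1 + t / (1 - t)) ^ r * ∑ W, setWeight t W * h W := by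
  have ht : 0 < 1 - t := by linarith
  have hu : 0 ≤ t / (1 - t) := div_nonneg h0 ht.le
  have hsplit : ∀ U : Finset ι, setWeight t U =
      (t / (1 - t)) ^ (U ∩ D).card * setWeight t (U \ D) := by
    intro U
    have hc : (U ∩ D).card + (U \ D).card = U.card := by
      rw [add_comm]; exact card_sdiff_add_card_inter U D
    have hU : U.card ≤ Fintype.card ι := card_le_univ U
    unfold setWeight
    rw [show Fintype.card ι - (U \ D).card = (Fintype.card ι - U.card) + (U ∩ D).card by omega,
      ← hc, div_pow, pow_add, pow_add]
    field_simp
  calc ∑ U, setWeight t U * h (U \ D)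
      = ∑ U, (fun x : Finset ι × Finset ι => (t / (1 - t)) ^ x.1.card *
          (setWeight t x.2 * h x.2)) (U ∩ D, U \ D) := by
        refine sum_congr rfl fun U _ => ?_
        simp only
        rw [hsplit]
        ring
    _ = ∑ x ∈ univ.image fun U : Finset ι => (U ∩ D, U \ D),
          (t / (1 - t)) ^ x.1.card * (setWeight t x.2 * h x.2) := by
        rw [sum_image]
        intro U _ U' _ hUU
        simp only [Prod.mk.injEq] at hUU
        rw [← sdiff_union_inter U D, ← sdiff_union_inter U' D, hUU.1, hUU.2]
    _ ≤ ∑ x ∈ D.powerset ×ˢ univ, (t / (1 - t)) ^ x.1.card * (setWeight t x.2 * h x.2) := by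
        refine sum_le_sum_of_subset_of_nonneg (fun x hx => ?_) fun x _ _ =>
          mul_nonneg (pow_nonneg hu _) (mul_nonneg (setWeight_nonneg h0 h1.le _) (hh _))
        obtain ⟨U, -, rfl⟩ := mem_image.1 hx
        simp
    _ = (t / (1 - t) + 1) ^ D.card * ∑ W, setWeight t W * h W := by
        rw [sum_product]
        simp only
        rw [← sum_mul_sum]
        congr 1
        simpa using sum_pow_mul_eq_add_pow (t / (1 - t)) 1 D
    _ ≤ (1 + t / (1 - t)) ^ r * ∑ W, setWeight t W * h W := by
        rw [add_comm (t / (1 - t))]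
        exact mul_le_mul_of_nonneg_right (pow_le_pow_right₀ (by linarith) hD)
          (sum_nonneg fun W _ => mul_nonneg (setWeight_nonneg h0 h1.le _) (hh _))

theorem tradeable_mixMass {c : Bool} {t l Q δ : ℝ} {r : ℕ} (h0 : 0 ≤ t) (h1 : t < 1)
    (hn : (1 - t) ^ Fintype.card ι < 1) (hQ : 0 ≤ Q) (hδ : 0 ≤ δ)
    (hb : (1 + t / (1 - t)) ^ r * Q ≤ δ * (1 - l - Q))
    (hc : (1 + t / (1 - t)) ^ r * Q * (1 - t) ^ Fintype.card ι ≤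
      δ * l * (1 - (1 - t) ^ Fintype.card ι)) :
    Tradeable (mixMass (ι := ι) c t l Q) δ r := by
  classical
  intro z hz g hg hm
  set D := univ.filter fun i => z i = some c with hDdef
  have hD : D.card ≤ r := by
    refine (card_le_card fun i hi => ?_).trans hz
    simp only [hDdef, mem_filter, mem_univ, true_and] at hi ⊢
    simp [hi]
  set N := 1 - (1 - t) ^ Fintype.card ι with hN
  have hN0 : 0 < N := by linarith
  set u := (1 + t / (1 - t)) ^ r with hu
  have hu0 : 0 ≤ u := pow_nonneg (add_nonneg zero_le_one (div_nonneg h0 (by linarith))) _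
  let h : Finset ι → ℝ := fun W => if Sat z (mark (some !c) c W) then g (mark (some !c) c W) else 0
  have hh : ∀ W, 0 ≤ h W := fun W => by simp only [h]; split_ifs <;> simp [hg]
  have hw := fun U : Finset ι => setWeight_nonneg h0 h1.le U
  -- full strings are never undetermined
  have hdet : ∀ x : ι → Option Bool, (∀ i, x i ≠ none) → ¬ (¬ Sat z x ∧ ¬ Fals z x) := by
    rintro x hx ⟨h2, h3⟩
    refine h2 fun i b hi => ?_
    by_contra h4
    refine h3 ⟨i, b, hi, ?_⟩
    rcases hxi : x i with _ | b'
    · exact absurd hxi (hx i)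
    · rw [hxi] at h4
      cases b <;> cases b' <;> simp_all
  have hL : ∑ x, mixMass c t l Q x * (if ¬ Sat z x ∧ ¬ Fals z x then g x else 0) ≤
      Q * ((u * ∑ W, setWeight t W * h W) / N) := by
    rw [sum_mixMass]
    rw [if_neg (hdet _ (by simp)), mul_zero, zero_add]
    have h2 : ∑ U ∈ univ.erase ∅, setWeight t U *
        (if ¬ Sat z (mark (some !c) c U) ∧ ¬ Fals z (mark (some !c) c U) then
          g (mark (some !c) c U) else 0) = 0 := by
      refine sum_eq_zero fun U _ => ?_
      rw [if_neg (hdet _ fun i => ?_), mul_zero]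
      unfold mark
      split_ifs <;> simp
    rw [h2, zero_div, mul_zero, add_zero]
    refine mul_le_mul_of_nonneg_left (div_le_div_of_nonneg_right ?_ hN0.le) hQ
    refine le_trans ?_ (sum_setWeight_sdiff_le h0 h1 D hD h hh)
    refine le_trans (sum_le_sum fun U _ => mul_le_mul_of_nonneg_left ?_ (hw U))
      (sum_le_sum_of_subset_of_nonneg (subset_univ _) fun U _ _ => mul_nonneg (hw _) (hh _))
    split_ifs with hU
    · have hsat : Sat z (mark (some !c) c (U \ D)) := by
        intro i b hi
        by_cases hic : b = c
        · subst hic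
          have : i ∈ D := by simp [hDdef, hi]
          simp [mark, this]
        · have hiU : i ∈ U := by
            by_contra hiU
            refine hU.2 ⟨i, b, hi, ?_⟩
            simp only [mark, hiU, if_false]
            cases b <;> cases c <;> simp_all
          have hiD : i ∉ D := by
            simp only [hDdef, mem_filter, mem_univ, true_and, hi, Option.some.injEq]
            exact hic
          simp only [mark, mem_sdiff, hiU, hiD, not_false_eq_true, and_self, if_true]
          cases b <;> cases c <;> simp_all
      have href : Refines (mark none c U) (mark (some !c) c (U \ D)) := by
        intro i hi
        have hiU : i ∉ U := fun hiU => hi (by simp [mark, hiU])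
        simp [mark, hiU]
      simp only [h, hsat, if_true]
      exact hm _ _ href
    · exact hh _
  have hR : l * h ∅ + (1 - l - Q) * ((∑ W ∈ univ.erase ∅, setWeight t W * h W) / N) ≤
      ∑ x, mixMass c t l Q x * (if Sat z x then g x else 0) := by
    rw [sum_mixMass]
    have h2 : 0 ≤ Q * ((∑ U ∈ univ.erase ∅, setWeight t U *
        (if Sat z (mark none c U) then g (mark none c U) else 0)) / N) := by
      refine mul_nonneg hQ (div_nonneg (sum_nonneg fun U _ => mul_nonneg (hw U) ?_) hN0.le)
      split_ifs <;> simp [hg]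
    have h3 : h ∅ = if Sat z (fun _ => some c) then g (fun _ => some c) else 0 := by
      simp only [h, mark_empty]
    rw [← h3]
    simp only [h] at h2 ⊢
    linarith
  refine hL.trans (le_trans ?_ (mul_le_mul_of_nonneg_left hR hδ))
  rw [← add_sum_erase univ _ (mem_univ ∅), setWeight_empty]
  set M := ∑ W ∈ univ.erase ∅, setWeight t W * h W with hM
  have hM0 : 0 ≤ M := sum_nonneg fun W _ => mul_nonneg (hw _) (hh _)
  have e1 : u * Q * (1 - t) ^ Fintype.card ι / N * h ∅ ≤ δ * l * h ∅ :=
    mul_le_mul_of_nonneg_right (by rwa [div_le_iff₀ hN0]) (hh _)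
  have e2 : u * Q * (M / N) ≤ δ * (1 - l - Q) * (M / N) :=
    mul_le_mul_of_nonneg_right hb (by positivity)
  calc Q * (u * ((1 - t) ^ Fintype.card ι * h ∅ + M) / N)
      = u * Q * (1 - t) ^ Fintype.card ι / N * h ∅ + u * Q * (M / N) := by ring
    _ ≤ δ * l * h ∅ + δ * (1 - l - Q) * (M / N) := add_le_add e1 e2
    _ = δ * (l * h ∅ + (1 - l - Q) * (M / N)) := by ring

/-- A distribution without stars is trivially tradeable. -/
theorem tradeable_of_no_star {ν : (ι → Option Bool) → ℝ} {δ : ℝ} (r : ℕ) (hδ : 0 ≤ δ)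
    (h0 : ∀ x, 0 ≤ ν x) (hν : ∀ x, (∃ i, x i = none) → ν x = 0) : Tradeable ν δ r := by
  classical
  intro z _ g hg _
  refine (sum_nonpos fun x _ => ?_).trans
    (mul_nonneg hδ (sum_nonneg fun x _ => mul_nonneg (h0 x) ?_))
  · split_ifs with h
    · rw [hν x, zero_mul]
      by_contra hx
      push Not at hx
      refine h.1 fun i b hi => ?_
      by_contra h4
      refine h.2 ⟨i, b, hi, ?_⟩
      rcases hxi : x i with _ | b'
      · exact absurd hxi (hx i)
      · rw [hxi] at h4
        cases b <;> cases b' <;> simp_all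
    · simp
  · split_ifs <;> simp [hg]

end Mixture

section Extend

variable {κ : Type} [Fintype κ] [DecidableEq κ]

/-- The string that agrees with `x` on `S` and with `τ` elsewhere. -/
def extend (τ : κ → Option Bool) (S : Finset κ) (x : {i // i ∈ S} → Option Bool) :
    κ → Option Bool :=
  fun i => if h : i ∈ S then x ⟨i, h⟩ else τ i

open Classical in
/-- The distribution of a string that agrees with `τ` outside of `S` and whose restriction to `S` is
distributed as `ν`. -/
noncomputable def extendMass (τ : κ → Option Bool) (S : Finset κ)
    (ν : ({i // i ∈ S} → Option Bool) → ℝ) (x : κ → Option Bool) : ℝ :=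
  if ∀ i, i ∉ S → x i = τ i then ν fun i => x i.1 else 0

theorem sum_extendMass (τ : κ → Option Bool) (S : Finset κ)
    (ν : ({i // i ∈ S} → Option Bool) → ℝ) (f : (κ → Option Bool) → ℝ) :
    ∑ x, extendMass τ S ν x * f x = ∑ x, ν x * f (extend τ S x) := by
  symm
  refine sum_of_injOn (extend τ S) ?_ (by simp) (fun x _ hx => ?_) fun x _ => ?_
  · intro x _ x' _ h
    funext i
    have := congrFun h i.1
    simpa [extend, i.2] using this
  · unfold extendMass
    rw [if_neg, zero_mul]
    intro h
    refine hx ⟨fun i => x i.1, by simp, ?_⟩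
    funext i
    by_cases hi : i ∈ S
    · simp [extend, hi]
    · simp [extend, hi, h i hi]
  · unfold extendMass
    rw [if_pos fun i hi => by simp [extend, hi]]
    congr 2
    funext i
    simp [extend, i.2]

theorem isProbMass_extendMass (τ : κ → Option Bool) (S : Finset κ)
    {ν : ({i // i ∈ S} → Option Bool) → ℝ} (hν : IsProbMass ν) :
    IsProbMass (extendMass τ S ν) := by
  refine ⟨fun x => ?_, ?_⟩
  · unfold extendMass
    split_ifs
    · exact hν.1 _
    · exact le_rfl
  · simpa [hν.2] using sum_extendMass τ S ν fun _ => 1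

theorem tradeable_extendMass {τ : κ → Option Bool} {S : Finset κ} (hτ : ∀ i, i ∉ S → τ i ≠ none)
    {ν : ({i // i ∈ S} → Option Bool) → ℝ} (hν0 : ∀ x, 0 ≤ ν x) {δ : ℝ} (hδ : 0 ≤ δ) {r : ℕ}
    (hν : Tradeable ν δ r) : Tradeable (extendMass τ S ν) δ r := by
  classical
  intro z hz g hg hm
  rw [sum_extendMass, sum_extendMass]
  by_cases hF : ∃ i b, i ∉ S ∧ z i = some b ∧ τ i = some (!b)
  · obtain ⟨i, b, hi, hzi, hτi⟩ := hF
    refine (sum_nonpos fun x _ => ?_).trans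
      (mul_nonneg hδ (sum_nonneg fun x _ => mul_nonneg (hν0 x) ?_))
    · rw [if_neg, mul_zero]
      exact fun h => h.2 ⟨i, b, hzi, by simp [extend, hi, hτi]⟩
    · split_ifs <;> simp [hg]
  · have hoff : ∀ i b, i ∉ S → z i = some b → τ i = some b := by
      intro i b hi hzi
      by_contra h
      refine hF ⟨i, b, hi, hzi, ?_⟩
      rcases hti : τ i with _ | b'
      · exact absurd hti (hτ i hi)
      · rw [hti] at h
        cases b <;> cases b' <;> simp_all
    have hS : ∀ x, Sat z (extend τ S x) ↔ Sat (fun i : {i // i ∈ S} => z i.1) x := by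
      intro x
      constructor
      · intro h i b hi
        simpa [extend, i.2] using h i.1 b hi
      · intro h i b hi
        by_cases his : i ∈ S
        · simpa [extend, his] using h ⟨i, his⟩ b hi
        · simp [extend, his, hoff i b his hi]
    have hFa : ∀ x, Fals z (extend τ S x) ↔ Fals (fun i : {i // i ∈ S} => z i.1) x := by
      intro x
      constructor
      · rintro ⟨i, b, h1, h2⟩
        by_cases his : i ∈ S
        · exact ⟨⟨i, his⟩, b, h1, by simpa [extend, his] using h2⟩
        · rw [show extend τ S x i = τ i by simp [extend, his], hoff i b his h1] at h2
          simp at h2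
      · rintro ⟨i, b, h1, h2⟩
        exact ⟨i.1, b, h1, by simpa [extend, i.2] using h2⟩
    simp only [hS, hFa]
    refine hν _ ?_ (fun x => g (extend τ S x)) (fun x => hg _) fun x y hxy => hm _ _ fun i hi => ?_
    · refine le_trans (card_le_card_of_injOn Subtype.val (fun i hi => ?_)
        Subtype.val_injective.injOn) hz
      simpa using hi
    · by_cases his : i ∈ S
      · simp only [extend, his, dif_pos] at hi ⊢
        exact hxy _ hi
      · simp [extend, his]

end Extend

end Switching

theorem massProb_prod_le {α β : Type} [Fintype α] [Fintype β] {f : α → ℝ} (hf : IsProbMass f)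
    {h : α → β → ℝ} (hh : ∀ a, IsProbMass (h a)) {E : α × β → Prop} {B : α → Prop} {ε ε' : ℝ}
    (hε : 0 ≤ ε) (hB : massProb f B ≤ ε')
    (hE : ∀ a, ¬ B a → massProb (h a) (fun b => E (a, b)) ≤ ε) :
    massProb (fun x : α × β => f x.1 * h x.1 x.2) E ≤ ε' + ε := by
  classical
  have h1 : massProb (fun x : α × β => f x.1 * h x.1 x.2) E =
      ∑ a, f a * massProb (h a) (fun b => E (a, b)) := by
    unfold massProb
    rw [Fintype.sum_prod_type]
    refine Finset.sum_congr rfl fun a _ => ?_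
    rw [Finset.mul_sum]
    refine Finset.sum_congr rfl fun b _ => ?_
    split_ifs <;> simp
  have h2 : ∀ a, f a * massProb (h a) (fun b => E (a, b)) ≤
      (if B a then f a else 0) + f a * ε := by
    intro a
    by_cases hBa : B a
    · rw [if_pos hBa]
      have h3 : massProb (h a) (fun b => E (a, b)) ≤ 1 := by
        rw [← (hh a).2]
        refine Finset.sum_le_sum fun b _ => ?_
        split_ifs
        · exact le_rfl
        · exact (hh a).1 b
      nlinarith [hf.1 a, mul_nonneg (hf.1 a) hε]
    · rw [if_neg hBa, zero_add]
      exact mul_le_mul_of_nonneg_left (hE a hBa) (hf.1 a)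
  rw [h1]
  refine (Finset.sum_le_sum fun a _ => h2 a).trans ?_
  rw [Finset.sum_add_distrib, ← Finset.sum_mul, hf.2, one_mul]
  refine add_le_add ?_ le_rfl
  unfold massProb at hB
  convert hB

theorem isProbMass_prod {α β : Type} [Fintype α] [Fintype β] {f : α → ℝ} (hf : IsProbMass f)
    {h : α → β → ℝ} (hh : ∀ a, IsProbMass (h a)) :
    IsProbMass (fun x : α × β => f x.1 * h x.1 x.2) := by
  refine ⟨fun x => mul_nonneg (hf.1 _) ((hh _).1 _), ?_⟩
  rw [Fintype.sum_prod_type]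
  simp [← Finset.mul_sum, (hh _).2, hf.2]

theorem IsProbMass.comp_equiv {α β : Type} [Fintype α] [Fintype β] {f : β → ℝ} (hf : IsProbMass f)
    (e : α ≃ β) : IsProbMass fun a => f (e a) :=
  ⟨fun _ => hf.1 _, (e.sum_comp f).trans hf.2⟩

theorem massProb_comp_equiv {α β : Type} [Fintype α] [Fintype β] (f : β → ℝ) (e : α ≃ β)
    (E : β → Prop) : massProb (fun a => f (e a)) (fun a => E (e a)) = massProb f E := by
  classical
  exact e.sum_comp fun b => if E b then f b else 0

namespace SipserProj

open Switching

variable {m d : ℕ}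

/-- A restriction is the family of its blocks. -/
noncomputable def blockEquiv (k : ℕ) :
    Restr m d (k + 1) ≃ (Addr m d k → Fin (fanIn m d k) → Option Bool) where
  toFun ρ := block ρ
  invFun f := fun b : Addr m d k × Fin (fanIn m d k) => f b.1 b.2
  left_inv _ := rfl
  right_inv _ := rfl

theorem proj_eq {k : ℕ} (ρ : Restr m d (k + 1)) (f : (Addr m d (k + 1) → Bool) → Bool) :
    proj ρ f = fun y => f (fill (blockEquiv k ρ) y) := rfl

/-- The input of `f` at which `psi k ω f` evaluates it. -/
noncomputable def subst : (k : ℕ) → Outcome m d k → (Addr m d 1 → Bool) → Addr m d k → Bool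
  | 0, _ => fun _ _ => false
  | 1, _ => fun y => y
  | k + 2, ω => fun y => fill (blockEquiv (k + 1) ω.1) (subst (k + 1) ω.2 y)

theorem psi_eq_subst : ∀ (k : ℕ) (ω : Outcome m d k) (f : (Addr m d k → Bool) → Bool),
    psi k ω f = fun y => f (subst k ω y)
  | 0, _, _ => rfl
  | 1, _, _ => rfl
  | k + 2, ω, f => by
    rw [psi, psi_eq_subst (k + 1), proj_eq]
    rfl

theorem certLE_fill {A κ : Type} (ρ : A → κ → Option Bool) (v : A × κ) :
    CertLE (fun y => fill ρ y v) 1 := by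
  unfold fill
  rcases h : ρ v.1 v.2 with _ | b
  · exact CertLE.of_eval v.1
  · exact certLE_const b 1

/-- All inputs of the output gate have certificates of size `s`. -/
def TopSmall {V U : Type} (C : BoolCircuit V) (s : ℕ) (E : (U → Bool) → V → Bool) : Prop :=
  (∀ v, CertLE (fun y => E y v) 1) ∧
    ∀ j g, 1 ≤ j → C.HasPath j g → CertLE (fun y => C.gateVal (E y) g) s

/-- The properties of the parameters that the proof uses: `s` is the width after the projections,
`δ` the factor for trading a block, and `γ` the base of the failure probability. -/
structure GoodParams (m d s : ℕ) (δ γ : ℝ) : Prop where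
  one_le_s : 1 ≤ s
  two_le_d : 2 ≤ d
  δ_nonneg : 0 ≤ δ
  γ_pos : 0 < γ
  γ_le_one : γ ≤ 1
  gain : (1 + 2 * δ / γ) ^ s ≤ 2
  one_le_m : 1 ≤ m
  lam_nonneg : 0 ≤ lam m
  lam_add_q : lam m + q m ≤ 1
  init_block : 2 * q m ≤ δ * (1 - lam m - q m)
  init_full : 2 * q m * (1 / 2) ^ m ≤ δ * lam m * (1 - (1 / 2) ^ m)
  t_nonneg : ∀ k, 1 ≤ k → k ≤ d - 1 → 0 ≤ t m d k
  t_lt_one : ∀ k, 1 ≤ k → k ≤ d - 1 → t m d k < 1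
  pow_lt_one : ∀ k n, 2 ≤ k → k ≤ d - 1 → Acceptable m d k n → (1 - t m d k) ^ n < 1
  qBlock_nonneg : ∀ k n, 2 ≤ k → k ≤ d - 1 → Acceptable m d k n → 0 ≤ qBlock m d k n
  lam_add_qBlock : ∀ k n, 2 ≤ k → k ≤ d - 1 → Acceptable m d k n → lam m + qBlock m d k n ≤ 1
  subseq_block : ∀ k n, 2 ≤ k → k ≤ d - 1 → Acceptable m d k n →
    (1 + t m d k / (1 - t m d k)) ^ s * qBlock m d k n ≤ δ * (1 - lam m - qBlock m d k n)
  subseq_full : ∀ k n, 2 ≤ k → k ≤ d - 1 → Acceptable m d k n →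
    (1 + t m d k / (1 - t m d k)) ^ s * qBlock m d k n * (1 - t m d k) ^ n ≤
      δ * lam m * (1 - (1 - t m d k) ^ n)

namespace GoodParams

variable {s : ℕ} {δ γ : ℝ}

theorem gain_one (H : GoodParams m d s δ γ) : (1 + 2 * δ / γ) ^ 1 ≤ 2 := by
  have h : 0 ≤ 2 * δ / γ := div_nonneg (mul_nonneg zero_le_two H.δ_nonneg) H.γ_pos.le
  exact (pow_le_pow_right₀ (by linarith) H.one_le_s).trans H.gain

theorem isProbMass_initBlock (H : GoodParams m d s δ γ) {k : ℕ} (hk : k + 1 = d) :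
    IsProbMass (mixMass (ι := Fin (fanIn m d k)) (circ d (k + 1)) (1 / 2) (lam m) (q m)) := by
  have h2 := H.two_le_d
  have hf : fanIn m d k = m := by
    unfold fanIn
    rw [if_neg (by omega), if_pos (by omega)]
  have h1 := H.one_le_m
  refine isProbMass_mixMass (by norm_num) (by norm_num) ?_ H.lam_nonneg (Real.sqrt_nonneg _)
    H.lam_add_q
  rw [Fintype.card_fin, hf]
  exact pow_lt_one₀ (by norm_num) (by norm_num) (by omega)

theorem tradeable_initBlock (H : GoodParams m d s δ γ) {k : ℕ} (hk : k + 1 = d) :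
    Tradeable (mixMass (ι := Fin (fanIn m d k)) (circ d (k + 1)) (1 / 2) (lam m) (q m)) δ 1 := by
  have h2 := H.two_le_d
  have hf : fanIn m d k = m := by
    unfold fanIn
    rw [if_neg (by omega), if_pos (by omega)]
  have h1 := H.one_le_m
  have e : (1 + (1 / 2 : ℝ) / (1 - 1 / 2)) ^ 1 = 2 := by norm_num
  have e2 : (1 - 1 / 2 : ℝ) = 1 / 2 := by norm_num
  refine tradeable_mixMass (by norm_num) (by norm_num) ?_ (Real.sqrt_nonneg _) H.δ_nonneg ?_ ?_
  · rw [Fintype.card_fin, hf]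
    exact pow_lt_one₀ (by norm_num) (by norm_num) (by omega)
  · rw [e]; exact H.init_block
  · rw [e, e2, Fintype.card_fin, hf]; exact H.init_full

theorem blockMass_spec (H : GoodParams m d s δ γ) {k : ℕ} (hk1 : 2 ≤ k + 1) (hk2 : k + 1 ≤ d - 1)
    (τ : Restr m d (k + 1)) (a : Addr m d k) :
    IsProbMass (blockMass τ a) ∧ Tradeable (blockMass τ a) δ s := by
  have ht0 := H.t_nonneg (k + 1) (by omega) hk2
  have ht1 := H.t_lt_one (k + 1) (by omega) hk2
  have hcard : Fintype.card {i // i ∈ stars τ a} = (stars τ a).card := Fintype.card_coe _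
  unfold blockMass
  split_ifs with h1 h2
  · have hp := isProbMass_productMass (ι := {i // i ∈ stars τ a}) (o := some !circ d (k + 1))
      (c := circ d (k + 1)) (by simp) ht0 ht1.le
    refine ⟨hp, tradeable_of_no_star s H.δ_nonneg hp.1 ?_⟩
    rintro x ⟨i, hi⟩
    exact Finset.prod_eq_zero (Finset.mem_univ i) (by simp [twoPoint, hi])
  · rw [not_or, not_not] at h1
    have hA := h1.2
    constructor
    · refine isProbMass_mixMass ht0 ht1.le ?_ H.lam_nonneg (H.qBlock_nonneg _ _ hk1 hk2 hA)
        (H.lam_add_qBlock _ _ hk1 hk2 hA)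
      rw [hcard]
      exact H.pow_lt_one _ _ hk1 hk2 hA
    · refine tradeable_mixMass ht0 ht1 ?_ (H.qBlock_nonneg _ _ hk1 hk2 hA) H.δ_nonneg
        (H.subseq_block _ _ hk1 hk2 hA) ?_
      · rw [hcard]
        exact H.pow_lt_one _ _ hk1 hk2 hA
      · rw [hcard]
        exact H.subseq_full _ _ hk1 hk2 hA
  · have hempty : stars τ a = ∅ := by
      rw [not_or] at h1
      by_contra hne
      obtain ⟨i, hi⟩ := Finset.nonempty_iff_ne_empty.2 hne
      have hi : block τ a i = none := by simpa [stars] using hi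
      unfold lift at h1 h2
      split_ifs at h1 h2 with h3 h4
      · simp at h1
      · simp [h4 i] at hi
      · simp at h2
    have : IsEmpty {i // i ∈ stars τ a} := by
      rw [hempty]; exact ⟨fun i => Finset.notMem_empty _ i.2⟩
    refine ⟨⟨fun _ => zero_le_one, by simp⟩,
      tradeable_of_no_star s H.δ_nonneg (fun _ => zero_le_one) ?_⟩
    rintro x ⟨i, _⟩
    exact isEmptyElim i

end GoodParams

/-- The law of the blocks under the restriction that refines `τ`. -/
noncomputable def refinedBlock {k : ℕ} (τ : Restr m d (k + 1)) (a : Addr m d k) :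
    (Fin (fanIn m d k) → Option Bool) → ℝ :=
  extendMass (block τ a) (stars τ a) (blockMass τ a)

theorem subseqMass_eq {k : ℕ} (τ ρ : Restr m d (k + 1)) :
    subseqMass τ ρ = blocks (refinedBlock τ) (blockEquiv k ρ) := by
  have hstar : ∀ a i, i ∉ stars τ a ↔ block τ a i ≠ none := fun a i => by simp [stars]
  unfold subseqMass blocks refinedBlock extendMass
  split_ifs with h
  · refine Finset.prod_congr rfl fun a _ => ?_
    rw [if_pos]
    · rfl
    · intro i hi
      exact h (a, i) ((hstar a i).1 hi)
  · push Not at h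
    obtain ⟨⟨a, i⟩, h1, h2⟩ := h
    symm
    refine Finset.prod_eq_zero (Finset.mem_univ a) ?_
    rw [if_neg]
    intro h3
    exact h2 (h3 i ((hstar a i).2 h1))

theorem initMass_eq {k : ℕ} (ρ : Restr m d (k + 1)) :
    initMass m d k ρ = blocks
      (fun _ => mixMass (circ d (k + 1)) (1 / 2) (lam m) (q m)) (blockEquiv k ρ) := rfl

namespace GoodParams

variable {s : ℕ} {δ γ : ℝ}

theorem refinedBlock_spec (H : GoodParams m d s δ γ) {k : ℕ} (hk1 : 2 ≤ k + 1)
    (hk2 : k + 1 ≤ d - 1) (τ : Restr m d (k + 1)) (a : Addr m d k) :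
    IsProbMass (refinedBlock τ a) ∧ Tradeable (refinedBlock τ a) δ s := by
  obtain ⟨h1, h2⟩ := H.blockMass_spec hk1 hk2 τ a
  exact ⟨isProbMass_extendMass _ _ h1, tradeable_extendMass
    (fun i hi => by simpa [stars] using hi) h1.1 H.δ_nonneg h2⟩

theorem isProbMass_initMass (H : GoodParams m d s δ γ) {k : ℕ} (hk : k + 1 = d) :
    IsProbMass (initMass m d k) :=
  (isProbMass_blocks fun _ : Addr m d k => H.isProbMass_initBlock hk).comp_equiv (blockEquiv k)

theorem isProbMass_subseqMass (H : GoodParams m d s δ γ) {k : ℕ} (hk1 : 2 ≤ k + 1)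
    (hk2 : k + 1 ≤ d - 1) (τ : Restr m d (k + 1)) : IsProbMass (subseqMass τ) := by
  rw [funext (subseqMass_eq τ)]
  exact (isProbMass_blocks fun a => (H.refinedBlock_spec hk1 hk2 τ a).1).comp_equiv (blockEquiv k)

theorem isProbMass_tailMass (H : GoodParams m d s δ γ) : ∀ k, k ≤ d - 1 → ∀ τ : Restr m d k,
    IsProbMass (tailMass m d k τ)
  | 0, _, _ => ⟨fun _ => zero_le_one, Fintype.sum_unique (fun _ : Unit => (1 : ℝ))⟩
  | 1, _, _ => ⟨fun _ => zero_le_one, Fintype.sum_unique (fun _ : Unit => (1 : ℝ))⟩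
  | k + 2, hk, τ =>
    isProbMass_prod (H.isProbMass_subseqMass (by omega) hk τ)
      fun ρ => H.isProbMass_tailMass (k + 1) (by omega) (lift ρ)

theorem isProbMass_psiMass (H : GoodParams m d s δ γ) : IsProbMass (psiMass m d) := by
  have h2 := H.two_le_d
  obtain ⟨e, rfl⟩ := Nat.exists_eq_add_of_le' h2
  exact isProbMass_prod (H.isProbMass_initMass (k := e + 1) rfl)
    fun ρ => H.isProbMass_tailMass (e + 1) (by omega) (lift ρ)

theorem wellDefined (H : GoodParams m d s δ γ) : WellDefined m d := by
  refine ⟨?_, fun k hk1 hk2 τ => H.isProbMass_subseqMass hk1 hk2 τ, H.isProbMass_psiMass⟩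
  have h2 := H.two_le_d
  obtain ⟨e, rfl⟩ := Nat.exists_eq_add_of_le' h2
  exact H.isProbMass_initMass (k := e + 1) rfl

/-- One round: the gates at distance `k` from the output get certificates of size `s`. -/
theorem massProb_round_le (H : GoodParams m d s δ γ) {k r : ℕ} (hr1 : 1 ≤ r)
    (hr : (1 + 2 * δ / γ) ^ r ≤ 2) {P : Restr m d (k + 1) → ℝ}
    {μ : Addr m d k → (Fin (fanIn m d k) → Option Bool) → ℝ} (hμ : ∀ a, IsProbMass (μ a))
    (hB : ∀ a, Tradeable (μ a) δ r) (hP : ∀ ρ, P ρ = blocks μ (blockEquiv k ρ))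
    {V : Type} (C : BoolCircuit V) (E : (Addr m d (k + 1) → Bool) → V → Bool)
    (hE : ∀ v, CertLE (fun y => E y v) 1)
    (hC : ∀ g, C.HasPath (k + 1) g → CertLE (fun y => C.gateVal (E y) g) r) :
    massProb P (fun ρ => ∃ g, C.HasPath k g ∧
      ¬ CertLE (fun y => C.gateVal (E (fill (blockEquiv k ρ) y)) g) s) ≤
      C.size * γ ^ (s + 1) := by
  have hPm : P = fun ρ => blocks μ (blockEquiv k ρ) := funext hP
  have hPp : ∀ ρ, 0 ≤ P ρ := fun ρ => by rw [hP]; exact (isProbMass_blocks hμ).1 _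
  refine (massProb_exists_le hPp _).trans ?_
  have hone : ∀ g, massProb P (fun ρ => C.HasPath k g ∧
      ¬ CertLE (fun y => C.gateVal (E (fill (blockEquiv k ρ) y)) g) s) ≤ γ ^ (s + 1) := by
    intro g
    by_cases hg : C.HasPath k g
    · refine (massProb_mono hPp fun ρ h => h.2).trans ?_
      have hl : ∀ l ∈ C.lits g, CertLE (fun y => BoolLit.val (E y) l) r := fun l _ =>
        ((hE l.1).beq l.2).mono hr1
      have hh : ∀ h ∈ C.inputs g, CertLE (fun y => C.gateVal (E y) h) r := fun h hhg =>
        hC h (hg.step hhg)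
      rw [hPm]
      rcases hA : C.isAnd g with _ | _
      · exact (massProb_comp_equiv (blocks μ) (blockEquiv k) (fun ρ =>
          ¬ CertLE (fun y => C.gateVal (E (fill ρ y)) g) s)).trans_le
          (massProb_not_certLE_le (g := fun x => C.gateVal (E x) g) hμ H.δ_nonneg H.γ_pos
            H.γ_le_one hr hB (C.gateVal_or E g hA hl hh) s)
      · have h := massProb_not_certLE_le (g := fun x => !C.gateVal (E x) g) hμ H.δ_nonneg H.γ_pos
            H.γ_le_one hr hB (fun x hx => by
              obtain ⟨Y, hY, h⟩ := C.gateVal_and E g hA hl hh x (by simpa using hx)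
              exact ⟨Y, hY, fun x' hx' => congrArg not (h x' hx')⟩) s
        simp only [certLE_not] at h
        exact (massProb_comp_equiv (blocks μ) (blockEquiv k) (fun ρ =>
          ¬ CertLE (fun y => C.gateVal (E (fill ρ y)) g) s)).trans_le h
    · simp only [hg, false_and]
      unfold massProb
      simp only [if_false, Finset.sum_const_zero]
      exact pow_nonneg H.γ_pos.le _
  calc ∑ g, massProb P (fun ρ => C.HasPath k g ∧
      ¬ CertLE (fun y => C.gateVal (E (fill (blockEquiv k ρ) y)) g) s)
      ≤ ∑ _g : Fin C.size, γ ^ (s + 1) := Finset.sum_le_sum fun g _ => hone g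
    _ = C.size * γ ^ (s + 1) := by simp

theorem massProb_tail_le (H : GoodParams m d s δ γ) {V : Type} (C : BoolCircuit V) :
    ∀ k, k + 1 ≤ d - 1 → ∀ (E : (Addr m d (k + 1) → Bool) → V → Bool),
      (∀ v, CertLE (fun y => E y v) 1) →
      (∀ j g, k + 1 ≤ j → C.HasPath j g → CertLE (fun y => C.gateVal (E y) g) s) →
      ∀ τ : Restr m d (k + 1), massProb (tailMass m d (k + 1) τ)
        (fun ω => ¬ TopSmall C s fun y => E (subst (k + 1) ω y)) ≤ k * (C.size * γ ^ (s + 1))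
  | 0, _, E, hE, hC, τ => by
    have : TopSmall C s E := ⟨hE, fun j g hj => hC j g hj⟩
    unfold massProb
    rw [Nat.cast_zero, zero_mul]
    refine (Finset.sum_eq_zero fun ω _ => ?_).le
    rw [if_neg]
    exact not_not.2 this
  | k + 1, hk, E, hE, hC, τ => by
    have hround := H.massProb_round_le (k := k + 1) H.one_le_s H.gain
      (fun a => (H.refinedBlock_spec (by omega) hk τ a).1)
      (fun a => (H.refinedBlock_spec (by omega) hk τ a).2) (subseqMass_eq τ) C E hE
      (fun g hg => hC _ g le_rfl hg)
    have hS : 0 ≤ (C.size : ℝ) * γ ^ (s + 1) :=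
      mul_nonneg (Nat.cast_nonneg _) (pow_nonneg H.γ_pos.le _)
    have h := massProb_prod_le (H.isProbMass_subseqMass (by omega) hk τ)
      (fun ρ => H.isProbMass_tailMass (k + 1) (by omega) (lift ρ))
      (E := fun ω => ¬ TopSmall C s fun y =>
        E (fill (blockEquiv (k + 1) ω.1) (subst (k + 1) ω.2 y)))
      (mul_nonneg (Nat.cast_nonneg k) hS) hround (fun ρ hρ => by
        push Not at hρ
        refine H.massProb_tail_le C k (by omega) (fun y => E (fill (blockEquiv (k + 1) ρ) y))
          (fun v => (hE v).comp fun b => certLE_fill _ b) (fun j g hj hg => ?_) (lift ρ)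
        rcases Nat.eq_or_lt_of_le hj with rfl | hj
        · exact hρ g hg
        · exact (hC j g hj hg).comp fun b => certLE_fill _ b)
    refine le_trans h (le_of_eq ?_)
    push_cast
    ring

theorem massProb_psi_le (H : GoodParams m d s δ γ) (C : BoolCircuit (Addr m d d))
    (hd : C.DepthLE d) :
    massProb (psiMass m d) (fun ω => ¬ TopSmall C s (subst d ω)) ≤
      d * (C.size * γ ^ (s + 1)) := by
  have h2 := H.two_le_d
  obtain ⟨e, rfl⟩ := Nat.exists_eq_add_of_le' h2
  have hno : ∀ j g, e + 2 ≤ j → ¬ C.HasPath j g := fun j g hj hg => by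
    have := hd j g hg
    omega
  have hround := H.massProb_round_le (k := e + 1) le_rfl H.gain_one
    (fun _ => H.isProbMass_initBlock rfl) (fun _ => H.tradeable_initBlock rfl)
    initMass_eq C (fun y => y) (fun v => CertLE.of_eval v)
    (fun g hg => absurd hg (hno _ g le_rfl))
  have hS : 0 ≤ (C.size : ℝ) * γ ^ (s + 1) :=
    mul_nonneg (Nat.cast_nonneg _) (pow_nonneg H.γ_pos.le _)
  have h := massProb_prod_le (H.isProbMass_initMass (k := e + 1) rfl)
    (fun ρ => H.isProbMass_tailMass (e + 1) (by omega) (lift ρ))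
    (E := fun ω => ¬ TopSmall C s fun y =>
      fill (blockEquiv (e + 1) ω.1) (subst (e + 1) ω.2 y))
    (mul_nonneg (Nat.cast_nonneg e) hS) hround (fun ρ hρ => by
      push Not at hρ
      refine H.massProb_tail_le C e (by omega) (fun y => fill (blockEquiv (e + 1) ρ) y)
        (fun b => certLE_fill _ b) (fun j g hj hg => ?_) (lift ρ)
      rcases Nat.eq_or_lt_of_le hj with rfl | hj
      · exact hρ g hg
      · exact absurd hg (hno j g hj))
  refine le_trans h ?_
  push_cast
  linarith

end GoodParams

theorem close_of_eq {ε : ℝ} (hε : 0 ≤ ε) {f g : (Addr m d 1 → Bool) → Bool} (h : f = g) :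
    Close m d ε f g := by
  subst h
  constructor <;> simpa [CloseUnder, massProb] using hε

theorem TopSmall.exists_cnf {s : ℕ} {C : BoolCircuit (Addr m d d)}
    {ω : Outcome m d d} (h : TopSmall C s (subst d ω)) (hA : C.isAnd C.out = true) (hs : 1 ≤ s) :
    ∃ F : NormalForm (Addr m d 1), F.width ≤ s ∧ psi d ω C.eval = F.evalCNF := by
  rw [psi_eq_subst]
  obtain ⟨F, h1, h2⟩ := _root_.exists_cnf (C.gateVal_and (subst d ω) C.out hA
    (fun l _ => ((h.1 l.1).beq l.2).mono hs)
    (fun g hg => h.2 1 g le_rfl (BoolCircuit.HasPath.out.step hg)))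
  exact ⟨F, h1, h2.symm⟩

theorem TopSmall.exists_dnf {s : ℕ} {C : BoolCircuit (Addr m d d)}
    {ω : Outcome m d d} (h : TopSmall C s (subst d ω)) (hA : C.isAnd C.out = false) (hs : 1 ≤ s) :
    ∃ F : NormalForm (Addr m d 1), F.width ≤ s ∧ psi d ω C.eval = F.evalDNF := by
  rw [psi_eq_subst]
  obtain ⟨F, h1, h2⟩ := _root_.exists_dnf (C.gateVal_or (subst d ω) C.out hA
    (fun l _ => ((h.1 l.1).beq l.2).mono hs)
    (fun g hg => h.2 1 g le_rfl (BoolCircuit.HasPath.out.step hg)))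
  exact ⟨F, h1, h2.symm⟩

end SipserProj

namespace SipserProj

open Real

/-- `m` is large, in terms of `a = 2^{-m/60}`. -/
structure Large (m : ℕ) (a : ℝ) : Prop where
  two_le : 2 ≤ m
  pos : 0 < a
  small : m * a ≤ 1 / 10000
  p_eq : p m = a ^ 60

theorem exists_large : ∃ m₀ : ℕ, ∀ m, m₀ ≤ m → ∃ a, Large m a := by
  have hr : |(2 : ℝ) ^ (-(1 / 60) : ℝ)| < 1 := by
    rw [abs_of_pos (by positivity)]
    exact Real.rpow_lt_one_of_one_lt_of_neg (by norm_num) (by norm_num)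
  have h := tendsto_pow_const_mul_const_pow_of_abs_lt_one 1 hr
  have h1 := h.eventually (ge_mem_nhds (show (0 : ℝ) < 1 / 10000 by norm_num))
  obtain ⟨m₀, h2⟩ := Filter.eventually_atTop.1 (h1.and (Filter.eventually_ge_atTop 2))
  refine ⟨m₀, fun m hm => ⟨((2 : ℝ) ^ (-(1 / 60) : ℝ)) ^ m, (h2 m hm).2, by positivity, ?_, ?_⟩⟩
  · simpa using (h2 m hm).1
  · unfold p
    rw [← pow_mul, ← Real.rpow_natCast, ← Real.rpow_mul (by norm_num)]
    congr 1
    push_cast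
    ring

theorem abs_add_log_one_sub_le {x : ℝ} (h0 : 0 ≤ x) (h1 : x ≤ 1 / 2) :
    |x + log (1 - x)| ≤ 2 * x ^ 2 := by
  have h := Real.abs_log_sub_add_sum_range_le (x := x) (by rw [abs_of_nonneg h0]; linarith) 1
  simp only [Finset.sum_range_one, Nat.cast_zero, zero_add, pow_one, div_one] at h
  rw [abs_of_nonneg h0] at h
  refine h.trans ?_
  rw [div_le_iff₀ (by linarith)]
  change x ^ 2 ≤ _
  nlinarith [mul_nonneg (sq_nonneg x) (by linarith : 0 ≤ 1 - 2 * x)]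

namespace Large

variable {m : ℕ} {a : ℝ}

theorem two_le_cast (H : Large m a) : (2 : ℝ) ≤ m := by exact_mod_cast H.two_le

theorem le_const (H : Large m a) : a ≤ 1 / 20000 := by
  have h1 := H.two_le_cast
  have h2 := H.small
  have h3 := H.pos
  nlinarith

theorem pow_le_pow (H : Large m a) {i j : ℕ} (h : j ≤ i) : a ^ i ≤ a ^ j :=
  pow_le_pow_of_le_one H.pos.le (by linarith [H.le_const]) h

theorem pow_succ_le (H : Large m a) (i : ℕ) : a ^ (i + 1) ≤ a ^ i / 20000 := by
  rw [pow_succ]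
  have := mul_le_mul_of_nonneg_left H.le_const (pow_nonneg H.pos.le i)
  linarith

theorem mul_pow_succ_le (H : Large m a) (i : ℕ) : m * a ^ (i + 1) ≤ a ^ i / 10000 := by
  have := mul_le_mul_of_nonneg_left H.small (pow_nonneg H.pos.le i)
  calc m * a ^ (i + 1) = a ^ i * (m * a) := by ring
    _ ≤ _ := by linarith

theorem sq_mul_pow_le (H : Large m a) (i : ℕ) : m ^ 2 * a ^ (i + 2) ≤ a ^ i / 100000000 := by
  have h1 := H.mul_pow_succ_le (i + 1)
  have h2 := H.mul_pow_succ_le i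
  have h3 := mul_le_mul_of_nonneg_left h1 (Nat.cast_nonneg m : (0 : ℝ) ≤ m)
  calc (m : ℝ) ^ 2 * a ^ (i + 2) = m * (m * a ^ (i + 1 + 1)) := by ring
    _ ≤ _ := by linarith

theorem q_eq (H : Large m a) : q m = a ^ 30 := by
  unfold q
  rw [H.p_eq, show a ^ 60 = (a ^ 30) ^ 2 by ring]
  exact Real.sqrt_sq (pow_nonneg H.pos.le _)

theorem exp_eq (H : Large m a) : Real.exp (-(m * log 2)) = a ^ 60 := by
  rw [← H.p_eq]
  unfold p
  rw [Real.rpow_def_of_pos (by norm_num)]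
  congr 1
  ring

theorem two_pow_eq (H : Large m a) : (2 : ℝ) ^ m = (a ^ 60)⁻¹ := by
  rw [← H.p_eq]
  unfold p
  rw [Real.rpow_neg (by norm_num), inv_inv, Real.rpow_natCast]

theorem w_arg (m : ℕ) : (m : ℝ) * 2 ^ m / logb 2 (Real.exp 1) = m * 2 ^ m * log 2 := by
  unfold logb
  rw [Real.log_exp, div_div_eq_mul_div, div_one]

theorem mul_w_le (H : Large m a) : a ^ 60 * w m ≤ m * log 2 := by
  have h : (w m : ℝ) ≤ m * 2 ^ m * log 2 := by
    unfold w
    rw [w_arg]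
    exact Nat.floor_le (by have := Real.log_pos (one_lt_two); positivity)
  have hp : 0 < a ^ 60 := pow_pos H.pos _
  rw [H.two_pow_eq] at h
  calc a ^ 60 * (w m : ℝ) ≤ a ^ 60 * (m * (a ^ 60)⁻¹ * log 2) := by gcongr
    _ = m * log 2 := by have := H.pos; field_simp

theorem le_mul_w (H : Large m a) : m * log 2 - a ^ 60 ≤ a ^ 60 * w m := by
  have h : m * 2 ^ m * log 2 < (w m : ℝ) + 1 := by
    unfold w
    rw [w_arg]
    exact Nat.lt_floor_add_one _
  have hp : 0 < a ^ 60 := pow_pos H.pos _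
  rw [H.two_pow_eq] at h
  have h2 : a ^ 60 * (m * (a ^ 60)⁻¹ * log 2) ≤ a ^ 60 * ((w m : ℝ) + 1) := by gcongr
  have h3 : a ^ 60 * (m * (a ^ 60)⁻¹ * log 2) = m * log 2 := by have := H.pos; field_simp
  linarith

theorem one_le_mul_w (H : Large m a) : 1 ≤ a ^ 60 * w m := by
  have h1 := H.le_mul_w
  have h2 := H.two_le_cast
  have h3 := Real.log_two_gt_d9
  have h4 : a ^ 60 ≤ 1 / 20000 := by
    have := H.pow_le_pow (show 1 ≤ 60 by norm_num)
    linarith [H.le_const]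
  nlinarith

theorem mul_w_le' (H : Large m a) : a ^ 60 * w m ≤ m := by
  have h1 := H.mul_w_le
  have h2 := Real.log_two_lt_d9
  have h3 := H.two_le_cast
  nlinarith

theorem inv_le_w (H : Large m a) : (a ^ 60)⁻¹ ≤ w m := by
  have hp : 0 < a ^ 60 := pow_pos H.pos _
  rw [inv_le_iff_one_le_mul₀ hp, mul_comm]
  exact H.one_le_mul_w

theorem w_le_div (H : Large m a) : (w m : ℝ) ≤ m / a ^ 60 := by
  rw [le_div_iff₀ (pow_pos H.pos _), mul_comm]
  exact H.mul_w_le'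

theorem one_le_w (H : Large m a) : (1 : ℝ) ≤ w m := by
  refine le_trans ?_ H.inv_le_w
  rw [one_le_inv₀ (pow_pos H.pos _)]
  exact pow_le_one₀ H.pos.le (by linarith [H.le_const])

theorem inv_pow_rpow (H : Large m a) : ((a ^ 60)⁻¹) ^ (5 / 4 : ℝ) = (a ^ 75)⁻¹ := by
  rw [Real.inv_rpow (pow_nonneg H.pos.le _), ← Real.rpow_natCast, ← Real.rpow_mul H.pos.le,
    ← Real.rpow_natCast]
  norm_num

theorem logb_w_le (H : Large m a) : logb 2 (w m) ≤ 2 * m := by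
  have hw : 0 < (w m : ℝ) := by linarith [H.one_le_w]
  rw [Real.logb_le_iff_le_rpow (by norm_num) hw]
  have h1 : (m : ℝ) ≤ 2 ^ m := by exact_mod_cast Nat.lt_two_pow_self.le
  calc (w m : ℝ) ≤ m / a ^ 60 := H.w_le_div
    _ = m * 2 ^ m := by rw [H.two_pow_eq, div_eq_mul_inv]
    _ ≤ 2 ^ m * 2 ^ m := by gcongr
    _ = 2 ^ (2 * (m : ℝ)) := by
      rw [← pow_add, ← Real.rpow_natCast]
      congr 1
      push_cast
      ring

theorem le_logb_w (H : Large m a) : m ≤ logb 2 (w m) := by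
  have hw : 0 < (w m : ℝ) := by linarith [H.one_le_w]
  rw [Real.le_logb_iff_rpow_le (by norm_num) hw, Real.rpow_natCast, H.two_pow_eq]
  exact H.inv_le_w

theorem lam_le (H : Large m a) : lam m ≤ 4 * m ^ 2 * a ^ 75 := by
  unfold lam
  have h1 := H.two_le_cast
  have h2 := H.le_logb_w
  have hw : (a ^ 75)⁻¹ ≤ (w m : ℝ) ^ (5 / 4 : ℝ) := by
    rw [← H.inv_pow_rpow]
    exact Real.rpow_le_rpow (by have := H.pos; positivity) H.inv_le_w (by norm_num)
  have hl : logb 2 (w m) ^ (3 / 2 : ℝ) ≤ 4 * m ^ 2 := by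
    calc logb 2 (w m) ^ (3 / 2 : ℝ) ≤ (2 * m : ℝ) ^ (3 / 2 : ℝ) :=
          Real.rpow_le_rpow (by linarith) H.logb_w_le (by norm_num)
      _ ≤ (2 * m : ℝ) ^ (2 : ℝ) := Real.rpow_le_rpow_of_exponent_le (by linarith) (by norm_num)
      _ = 4 * m ^ 2 := by rw [Real.rpow_two]; ring
  have hp : 0 < a ^ 75 := pow_pos H.pos _
  calc logb 2 (w m) ^ (3 / 2 : ℝ) / (w m : ℝ) ^ (5 / 4 : ℝ) ≤ 4 * m ^ 2 / (a ^ 75)⁻¹ :=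
        div_le_div₀ (by positivity) hl (by positivity) hw
    _ = 4 * m ^ 2 * a ^ 75 := by rw [div_inv_eq_mul]

theorem le_lam (H : Large m a) : a ^ 75 ≤ lam m := by
  unfold lam
  have h1 := H.two_le_cast
  have hp : 0 < a ^ 75 := pow_pos H.pos _
  have hw0 : 0 < (w m : ℝ) := by linarith [H.one_le_w]
  have hw : (w m : ℝ) ^ (5 / 4 : ℝ) ≤ (m : ℝ) ^ (5 / 4 : ℝ) * (a ^ 75)⁻¹ := by
    rw [← H.inv_pow_rpow, ← Real.mul_rpow (by linarith) (by have := H.pos; positivity),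
      ← div_eq_mul_inv]
    exact Real.rpow_le_rpow hw0.le H.w_le_div (by norm_num)
  have hl : (m : ℝ) ^ (5 / 4 : ℝ) ≤ logb 2 (w m) ^ (3 / 2 : ℝ) :=
    (Real.rpow_le_rpow_of_exponent_le (by linarith) (by norm_num)).trans
      (Real.rpow_le_rpow (by linarith) H.le_logb_w (by norm_num))
  rw [le_div_iff₀ (Real.rpow_pos_of_pos hw0 _)]
  refine le_trans ?_ hl
  calc a ^ 75 * (w m : ℝ) ^ (5 / 4 : ℝ) ≤ a ^ 75 * ((m : ℝ) ^ (5 / 4 : ℝ) * (a ^ 75)⁻¹) := by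
        gcongr
    _ = _ := by have := H.pos; field_simp

theorem lam_le' (H : Large m a) : lam m ≤ a ^ 73 / 10000000 := by
  have h1 := H.lam_le
  have h2 := H.sq_mul_pow_le 73
  have h3 := pow_pos H.pos 73
  linarith

/-- The estimate `(1 - t)^x ≈ p` for `t ≈ q` and `x ≈ qw`. -/
theorem abs_rpow_sub_le (H : Large m a) {t θ x y b : ℝ} (hθ0 : 0 ≤ θ) (hθ : θ ≤ 1)
    (ht : |t - a ^ 30| ≤ a ^ 30 * θ) (hx : |x - a ^ 30 * w m| ≤ y)
    (hb : 4 * a ^ 30 * y + 8 * (m * a ^ 30) + m * θ + a ^ 60 ≤ b) (hb1 : b ≤ 1) :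
    |(1 - t) ^ x - a ^ 60| ≤ 2 * b * a ^ 60 := by
  have hq : 0 < a ^ 30 := pow_pos H.pos _
  have hp : 0 < a ^ 60 := pow_pos H.pos _
  have hqs : a ^ 30 ≤ 1 / 20000 := by
    have := H.pow_le_pow (show 1 ≤ 30 by norm_num)
    linarith [H.le_const]
  have ht' := abs_le.1 ht
  have hqθ : a ^ 30 * θ ≤ a ^ 30 := by nlinarith
  have ht0 : 0 ≤ t := by linarith
  have ht2 : t ≤ 2 * a ^ 30 := by linarith
  have hth : t ≤ 1 / 2 := by linarith
  have hlog := abs_add_log_one_sub_le ht0 hth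
  have hlog' : |log (1 - t)| ≤ 4 * a ^ 30 := by
    have h := abs_sub (t + log (1 - t)) t
    rw [add_sub_cancel_left, abs_of_nonneg ht0] at h
    nlinarith
  have hw0 : 0 ≤ (w m : ℝ) := Nat.cast_nonneg _
  have hy : 0 ≤ y := (abs_nonneg _).trans hx
  have e1 : |(x - a ^ 30 * w m) * log (1 - t)| ≤ 4 * a ^ 30 * y := by
    rw [abs_mul, mul_comm]
    exact mul_le_mul hlog' hx (abs_nonneg _) (by positivity)
  have hpw := H.mul_w_le'
  have e2 : |a ^ 30 * w m * (t + log (1 - t))| ≤ 8 * (m * a ^ 30) := by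
    rw [abs_mul, abs_of_nonneg (by positivity : 0 ≤ a ^ 30 * w m)]
    calc a ^ 30 * w m * |t + log (1 - t)| ≤ a ^ 30 * w m * (2 * (2 * a ^ 30) ^ 2) := by
          refine mul_le_mul_of_nonneg_left (hlog.trans ?_) (by positivity)
          gcongr
      _ = 8 * a ^ 30 * (a ^ 60 * w m) := by ring
      _ ≤ 8 * a ^ 30 * m := by gcongr
      _ = _ := by ring
  have e3 : |a ^ 30 * w m * (t - a ^ 30)| ≤ m * θ := by
    rw [abs_mul, abs_of_nonneg (by positivity : 0 ≤ a ^ 30 * w m)]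
    calc a ^ 30 * w m * |t - a ^ 30| ≤ a ^ 30 * w m * (a ^ 30 * θ) := by gcongr
      _ = a ^ 60 * w m * θ := by ring
      _ ≤ m * θ := by gcongr
  have e4 : |a ^ 60 * w m - m * log 2| ≤ a ^ 60 := by
    rw [abs_le]
    constructor <;> linarith [H.mul_w_le, H.le_mul_w]
  set e := log (1 - t) * x + m * log 2 with he
  have hsum : |e| ≤ b := by
    have h1 : e = (x - a ^ 30 * w m) * log (1 - t) + a ^ 30 * w m * (t + log (1 - t)) -
        a ^ 30 * w m * (t - a ^ 30) - (a ^ 60 * w m - m * log 2) := by rw [he]; ring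
    rw [h1]
    refine (abs_sub _ _).trans ?_
    have h2 := abs_sub ((x - a ^ 30 * w m) * log (1 - t) + a ^ 30 * w m * (t + log (1 - t)))
      (a ^ 30 * w m * (t - a ^ 30))
    have h3 := abs_add_le ((x - a ^ 30 * w m) * log (1 - t)) (a ^ 30 * w m * (t + log (1 - t)))
    linarith
  have h1 : (1 - t) ^ x = a ^ 60 * Real.exp e := by
    rw [Real.rpow_def_of_pos (by linarith), ← H.exp_eq, ← Real.exp_add]
    congr 1
    rw [he]
    ring
  have h2 := Real.abs_exp_sub_one_le (hsum.trans hb1)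
  rw [h1, show a ^ 60 * Real.exp e - a ^ 60 = a ^ 60 * (Real.exp e - 1) by ring, abs_mul,
    abs_of_pos hp, mul_comm]
  refine mul_le_mul_of_nonneg_right ?_ hp.le
  linarith

/-- All `t_k` are close to `q`. -/
theorem abs_tAux_sub_le (H : Large m a) (j : ℕ) (hj : (4 * m) ^ (j + 1) * a ^ 12 ≤ a ^ 6) :
    |tAux m j - a ^ 30| ≤ a ^ 30 * ((4 * m) ^ j * a ^ 12) := by
  have hq : 0 < a ^ 30 := pow_pos H.pos _
  have hm := H.two_le_cast
  have hlam0 : 0 ≤ lam m := (pow_pos H.pos 75).le.trans H.le_lam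
  have hlamq : lam m / a ^ 30 ≤ a ^ 30 * (a ^ 13 / 10000000) := by
    rw [div_le_iff₀ hq]
    refine H.lam_le'.trans (le_of_eq ?_)
    ring
  have h13 : a ^ 13 ≤ a ^ 12 / 20000 := H.pow_succ_le 12
  have h12 := pow_pos H.pos 12
  induction j with
  | zero =>
    rw [tAux, H.p_eq, H.q_eq, pow_zero, one_mul]
    have h1 : (a ^ 60 - lam m) / a ^ 30 - a ^ 30 = -(lam m / a ^ 30) := by
      field_simp
      ring
    rw [h1, abs_neg, abs_of_nonneg (by positivity)]
    refine hlamq.trans (mul_le_mul_of_nonneg_left ?_ hq.le)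
    linarith
  | succ j ih =>
    have hpow : (1 : ℝ) ≤ (4 * m) ^ j := one_le_pow₀ (by linarith)
    set X : ℝ := (4 * m) ^ j * a ^ 12 with hX
    have hX0 : a ^ 12 ≤ X := by nlinarith
    have hj' : 4 * m * (4 * m * X) ≤ a ^ 6 := by
      refine le_trans (le_of_eq ?_) hj
      rw [hX]; ring
    have hX1 : 0 ≤ X := by linarith
    have h8 : 4 * m * X ≤ a ^ 6 := by nlinarith [mul_nonneg (by linarith : (0:ℝ) ≤ 4 * m) hX1]
    have ht := ih (by
      refine le_trans (le_of_eq ?_) h8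
      rw [hX]; ring)
    have h6 : a ^ 6 ≤ 1 / 20000 := by
      have := H.pow_le_pow (show 1 ≤ 6 by norm_num)
      linarith [H.le_const]
    have h30 := H.mul_pow_succ_le 29
    have h60 := H.pow_succ_le 59
    have h29 := H.pow_le_pow (show 13 ≤ 29 by norm_num)
    have h59 := H.pow_le_pow (show 13 ≤ 59 by norm_num)
    norm_num only at h30 h60
    have hXle : X ≤ 1 := by nlinarith
    have h := H.abs_rpow_sub_le (x := a ^ 30 * w m) (y := 0)
      (b := m * X + a ^ 12 / 10000) hX1 hXle ht (by simp) (by linarith) (by linarith)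
    rw [tAux, H.q_eq]
    have h2 : ((1 - tAux m j) ^ (a ^ 30 * (w m : ℝ)) - lam m) / a ^ 30 - a ^ 30 =
        ((1 - tAux m j) ^ (a ^ 30 * (w m : ℝ)) - a ^ 60) / a ^ 30 - lam m / a ^ 30 := by
      field_simp
      ring
    rw [h2]
    refine (abs_sub _ _).trans ?_
    rw [abs_div, abs_of_pos hq, abs_of_nonneg (by positivity : 0 ≤ lam m / a ^ 30)]
    have h3 : |(1 - tAux m j) ^ (a ^ 30 * (w m : ℝ)) - a ^ 60| / a ^ 30 ≤
        a ^ 30 * (2 * (m * X + a ^ 12 / 10000)) := by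
      rw [div_le_iff₀ hq]
      refine h.trans (le_of_eq ?_)
      ring
    have h4 : a ^ 30 * (2 * (m * X + a ^ 12 / 10000)) + a ^ 30 * (a ^ 13 / 10000000) ≤
        a ^ 30 * (4 * m * X) := by
      rw [← mul_add]
      refine mul_le_mul_of_nonneg_left ?_ hq.le
      nlinarith
    calc _ ≤ a ^ 30 * (2 * (m * X + a ^ 12 / 10000)) + a ^ 30 * (a ^ 13 / 10000000) :=
          add_le_add h3 hlamq
      _ ≤ a ^ 30 * (4 * m * X) := h4
      _ = a ^ 30 * ((4 * m) ^ (j + 1) * a ^ 12) := by rw [hX]; ring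

end Large

/-- `n^{1/(6(d-1))}`. -/
noncomputable def sixthRoot (m d : ℕ) : ℝ := (numVars m d : ℝ) ^ (1 / (6 * ((d : ℝ) - 1)))

namespace Large

variable {m d : ℕ} {a : ℝ}

theorem exists_theta (H : Large m a) (hd : (4 * m) ^ d * a ^ 12 ≤ a ^ 6) {k : ℕ} (hk : 1 ≤ k)
    (hkd : k ≤ d - 1) :
    ∃ θ, 0 ≤ θ ∧ m * θ ≤ a ^ 6 / 4 ∧ θ ≤ 1 / 2 ∧ |t m d k - a ^ 30| ≤ a ^ 30 * θ := by
  have hm := H.two_le_cast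
  have h12 := pow_pos H.pos 12
  have h1 : (4 * m : ℝ) ^ (d - 1 - k + 1) * a ^ 12 ≤ a ^ 6 := by
    refine le_trans ?_ hd
    gcongr
    · linarith
    · omega
  have h2 : m * ((4 * m : ℝ) ^ (d - 1 - k) * a ^ 12) ≤ a ^ 6 / 4 := by
    rw [pow_succ] at h1
    linarith
  have h0 : 0 ≤ (4 * m : ℝ) ^ (d - 1 - k) * a ^ 12 := by positivity
  have h6 : a ^ 6 ≤ 1 / 20000 := by
    have := H.pow_le_pow (show 1 ≤ 6 by norm_num)
    linarith [H.le_const]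
  exact ⟨_, h0, h2, by nlinarith, H.abs_tAux_sub_le _ h1⟩

theorem t_bounds (H : Large m a) (hd : (4 * m) ^ d * a ^ 12 ≤ a ^ 6) {k : ℕ} (hk : 1 ≤ k)
    (hkd : k ≤ d - 1) : a ^ 30 / 2 ≤ t m d k ∧ t m d k ≤ 2 * a ^ 30 := by
  obtain ⟨θ, h0, h1, h2, h3⟩ := H.exists_theta hd hk hkd
  have hq := pow_pos H.pos 30
  have h4 := abs_le.1 h3
  constructor <;> nlinarith

theorem w_rpow_beta_le (H : Large m a) {k : ℕ} (hd : 1 ≤ d) :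
    4 * a ^ 30 * (w m : ℝ) ^ beta k d ≤ a ^ 4 / 2500 := by
  have hm := H.two_le_cast
  have hβ : beta k d ≤ 5 / 12 := by
    unfold beta
    have hd' : (1 : ℝ) ≤ d := by exact_mod_cast hd
    have hk : (0 : ℝ) ≤ k := Nat.cast_nonneg k
    have : ((d : ℝ) - k - 1) / (12 * d) ≤ 1 / 12 := by
      rw [div_le_div_iff₀ (by linarith) (by norm_num)]
      linarith
    linarith
  have h25 : 0 < a ^ 25 := pow_pos H.pos _
  have h1 : (w m : ℝ) ^ beta k d ≤ m * (a ^ 25)⁻¹ := by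
    calc (w m : ℝ) ^ beta k d ≤ (w m : ℝ) ^ (5 / 12 : ℝ) :=
          Real.rpow_le_rpow_of_exponent_le H.one_le_w hβ
      _ ≤ (m / a ^ 60) ^ (5 / 12 : ℝ) :=
          Real.rpow_le_rpow (Nat.cast_nonneg _) H.w_le_div (by norm_num)
      _ = (m : ℝ) ^ (5 / 12 : ℝ) * (a ^ 25)⁻¹ := by
          rw [Real.div_rpow (by linarith) (pow_nonneg H.pos.le _), div_eq_mul_inv,
            ← Real.rpow_natCast, ← Real.rpow_mul H.pos.le, ← Real.rpow_natCast]
          norm_num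
      _ ≤ (m : ℝ) ^ (1 : ℝ) * (a ^ 25)⁻¹ := by
          gcongr
          · linarith
          · norm_num
      _ = m * (a ^ 25)⁻¹ := by rw [Real.rpow_one]
  calc 4 * a ^ 30 * (w m : ℝ) ^ beta k d ≤ 4 * a ^ 30 * (m * (a ^ 25)⁻¹) := by
        have := H.pos
        gcongr
    _ = 4 * (m * a ^ 5) := by have := H.pos; field_simp
    _ ≤ a ^ 4 / 2500 := by linarith [H.mul_pow_succ_le 4]

theorem pow_bounds (H : Large m a) (hd : (4 * m) ^ d * a ^ 12 ≤ a ^ 6) {k n : ℕ} (hk : 1 ≤ k)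
    (hkd : k ≤ d - 1) (hA : Acceptable m d k n) :
    a ^ 60 / 2 ≤ (1 - t m d k) ^ n ∧ (1 - t m d k) ^ n ≤ 3 / 2 * a ^ 60 := by
  obtain ⟨θ, h0, h1, h2, h3⟩ := H.exists_theta hd hk hkd
  have ha := H.le_const
  have h4 := H.pow_le_pow (show 1 ≤ 4 by norm_num)
  have h6 := H.pow_le_pow (show 1 ≤ 6 by norm_num)
  have h60 := H.pow_le_pow (show 1 ≤ 60 by norm_num)
  have h29 := H.pow_le_pow (show 1 ≤ 29 by norm_num)
  have h30 := H.mul_pow_succ_le 29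
  norm_num only at h30
  have hw := H.w_rpow_beta_le (k := k) (d := d) (by omega)
  unfold Acceptable at hA
  rw [H.q_eq] at hA
  have h := H.abs_rpow_sub_le h0 (by linarith) h3 hA (b := 1 / 4) (by linarith) (by norm_num)
  rw [Real.rpow_natCast] at h
  have h5 := abs_le.1 h
  constructor <;> linarith

theorem w0_le (H : Large m a) (hd : (4 * m) ^ d * a ^ 12 ≤ a ^ 6) (h2 : 2 ≤ d) :
    (w0 m d : ℝ) ≤ 3 / a ^ 60 := by
  have hp : 0 < a ^ 60 := pow_pos H.pos _
  have hq : 0 < a ^ 30 := pow_pos H.pos _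
  obtain ⟨ht1, ht2⟩ := H.t_bounds hd (k := 1) le_rfl (by omega)
  have hqs : a ^ 30 ≤ 1 / 20000 := by
    have := H.pow_le_pow (show 1 ≤ 30 by norm_num)
    linarith [H.le_const]
  have hmem : ⌈2 / a ^ 60⌉₊ ∈ {r : ℕ | (1 - t m d 1) ^ (q m * (r : ℝ)) ≤ 1 / 2} := by
    rw [Set.mem_ofPred_eq, H.q_eq]
    have hc := Nat.le_ceil (2 / a ^ 60)
    have hx : 2 ≤ a ^ 60 * (⌈2 / a ^ 60⌉₊ : ℝ) := by
      rw [div_le_iff₀ hp] at hc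
      linarith
    have hlog : log (1 - t m d 1) ≤ -(a ^ 30 / 2) := by
      have := Real.log_le_sub_one_of_pos (show 0 < 1 - t m d 1 by linarith)
      linarith
    rw [Real.rpow_def_of_pos (by linarith)]
    calc Real.exp (log (1 - t m d 1) * (a ^ 30 * (⌈2 / a ^ 60⌉₊ : ℝ)))
        ≤ Real.exp (-1) := by
          refine Real.exp_le_exp.2 ?_
          calc log (1 - t m d 1) * (a ^ 30 * (⌈2 / a ^ 60⌉₊ : ℝ))
              ≤ -(a ^ 30 / 2) * (a ^ 30 * (⌈2 / a ^ 60⌉₊ : ℝ)) := by gcongr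
            _ = -(a ^ 60 * (⌈2 / a ^ 60⌉₊ : ℝ)) / 2 := by ring
            _ ≤ -1 := by linarith
      _ ≤ 1 / 2 := by
          rw [Real.exp_neg, inv_eq_one_div]
          exact one_div_le_one_div_of_le (by norm_num) (by linarith [Real.add_one_le_exp (1 : ℝ)])
  have h1 : w0 m d ≤ ⌈2 / a ^ 60⌉₊ := Nat.sInf_le hmem
  have h3 : (⌈2 / a ^ 60⌉₊ : ℝ) < 2 / a ^ 60 + 1 := Nat.ceil_lt_add_one (by positivity)
  have h4 : (1 : ℝ) ≤ 1 / a ^ 60 := by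
    rw [le_div_iff₀ hp, one_mul]
    exact pow_le_one₀ H.pos.le (by linarith [H.le_const])
  calc (w0 m d : ℝ) ≤ (⌈2 / a ^ 60⌉₊ : ℝ) := by exact_mod_cast h1
    _ ≤ 2 / a ^ 60 + 1 / a ^ 60 := by linarith
    _ = 3 / a ^ 60 := by ring

theorem one_le_w0 (H : Large m a) (hd : (4 * m) ^ d * a ^ 12 ≤ a ^ 6) (h2 : 2 ≤ d) :
    1 ≤ w0 m d := by
  by_contra h
  have h0 : w0 m d = 0 := by omega
  unfold w0 at h0
  rcases Nat.sInf_eq_zero.1 h0 with h1 | h1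
  · rw [Set.mem_ofPred_eq, Nat.cast_zero, mul_zero, Real.rpow_zero] at h1
    norm_num at h1
  · have hp : 0 < a ^ 60 := pow_pos H.pos _
    obtain ⟨ht1, ht2⟩ := H.t_bounds hd (k := 1) le_rfl (by omega)
    have hq : 0 < a ^ 30 := pow_pos H.pos _
    have hqs : a ^ 30 ≤ 1 / 20000 := by
      have := H.pow_le_pow (show 1 ≤ 30 by norm_num)
      linarith [H.le_const]
    obtain ⟨n, hn⟩ := exists_pow_lt_of_lt_one (show (0 : ℝ) < 1 / 2 by norm_num)
      (show (1 - t m d 1) ^ (a ^ 30) < 1 from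
        Real.rpow_lt_one (by linarith) (by linarith) hq)
    have : n ∈ {r : ℕ | (1 - t m d 1) ^ (q m * (r : ℝ)) ≤ 1 / 2} := by
      rw [Set.mem_ofPred_eq, H.q_eq, Real.rpow_mul (by linarith), Real.rpow_natCast]
      exact hn.le
    rw [h1] at this
    exact this

theorem numVars_eq (m e : ℕ) : numVars m (e + 2) = w m ^ e * m * w0 m (e + 2) := by
  unfold numVars
  rw [Finset.prod_range_succ', Finset.prod_range_succ]
  congr 1
  congr 1
  · rw [Finset.prod_congr rfl (g := fun _ => w m), Finset.prod_const, Finset.card_range]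
    intro k hk
    have := Finset.mem_range.1 hk
    unfold fanIn
    rw [if_neg (by omega), if_neg (by omega)]
  · simp [fanIn]

theorem numVars_le (H : Large m a) (hd : (4 * m) ^ d * a ^ 12 ≤ a ^ 6) (h2 : 2 ≤ d) :
    (numVars m d : ℝ) ≤ (3 * m / a ^ 60) ^ (d - 1) := by
  have hw0 := H.w0_le hd h2
  obtain ⟨e, rfl⟩ := Nat.exists_eq_add_of_le' h2
  have hm := H.two_le_cast
  have hp : 0 < a ^ 60 := pow_pos H.pos _
  rw [numVars_eq, show e + 2 - 1 = e + 1 by omega, pow_succ]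
  push_cast
  have h1 : (w m : ℝ) ≤ 3 * m / a ^ 60 := H.w_le_div.trans (by gcongr; linarith)
  calc (w m : ℝ) ^ e * m * w0 m (e + 2) ≤ (3 * m / a ^ 60) ^ e * m * (3 / a ^ 60) := by gcongr
    _ = _ := by ring

theorem w_pow_le_numVars (H : Large m a) (hd : (4 * m) ^ d * a ^ 12 ≤ a ^ 6) (h2 : 2 ≤ d) :
    (w m : ℝ) ^ (d - 2) ≤ numVars m d := by
  have hw0 := H.one_le_w0 hd h2
  obtain ⟨e, rfl⟩ := Nat.exists_eq_add_of_le' h2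
  have hm := H.two_le
  rw [numVars_eq, show e + 2 - 2 = e by omega, mul_assoc]
  push_cast
  have h1 : (1 : ℝ) ≤ (m : ℝ) * w0 m (e + 2) := by
    have : 1 ≤ m * w0 m (e + 2) := Nat.mul_pos (by omega) hw0
    exact_mod_cast this
  exact le_mul_of_one_le_right (by positivity) h1

theorem one_le_numVars (H : Large m a) (hd : (4 * m) ^ d * a ^ 12 ≤ a ^ 6) (h2 : 2 ≤ d) :
    (1 : ℝ) ≤ numVars m d :=
  (one_le_pow₀ H.one_le_w).trans (H.w_pow_le_numVars hd h2)

theorem one_le_sixthRoot (H : Large m a) (hd : (4 * m) ^ d * a ^ 12 ≤ a ^ 6) (h2 : 2 ≤ d) :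
    1 ≤ sixthRoot m d := by
  have h : (2 : ℝ) ≤ d := by exact_mod_cast h2
  exact Real.one_le_rpow (H.one_le_numVars hd h2)
    (div_nonneg zero_le_one (mul_nonneg (by norm_num) (by linarith)))

theorem sixthRoot_le (H : Large m a) (hd : (4 * m) ^ d * a ^ 12 ≤ a ^ 6) (h2 : 2 ≤ d) :
    sixthRoot m d ≤ 3 * m * (a ^ 10)⁻¹ := by
  have hm := H.two_le_cast
  have h : (2 : ℝ) ≤ d := by exact_mod_cast h2
  have hp : 0 < a ^ 60 := pow_pos H.pos _
  have h10 : 0 < a ^ 10 := pow_pos H.pos _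
  have hd1 : ((d - 1 : ℕ) : ℝ) = (d : ℝ) - 1 := by
    rw [Nat.cast_sub (by omega), Nat.cast_one]
  unfold sixthRoot
  calc (numVars m d : ℝ) ^ (1 / (6 * ((d : ℝ) - 1)))
      ≤ ((3 * m / a ^ 60) ^ (d - 1)) ^ (1 / (6 * ((d : ℝ) - 1))) :=
        Real.rpow_le_rpow (Nat.cast_nonneg _) (H.numVars_le hd h2)
          (div_nonneg zero_le_one (mul_nonneg (by norm_num) (by linarith)))
    _ = (3 * m / a ^ 60) ^ (1 / 6 : ℝ) := by
        rw [← Real.rpow_natCast, ← Real.rpow_mul (by positivity), hd1]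
        congr 1
        have : (d : ℝ) - 1 ≠ 0 := by linarith
        field_simp
    _ = (3 * m : ℝ) ^ (1 / 6 : ℝ) * (a ^ 10)⁻¹ := by
        rw [Real.div_rpow (by linarith) hp.le, div_eq_mul_inv,
          ← Real.rpow_natCast, ← Real.rpow_mul H.pos.le, ← Real.rpow_natCast]
        norm_num
    _ ≤ (3 * m : ℝ) ^ (1 : ℝ) * (a ^ 10)⁻¹ := by
        gcongr
        · linarith
        · norm_num
    _ = _ := by rw [Real.rpow_one]

theorem le_sixthRoot (H : Large m a) (hd : (4 * m) ^ d * a ^ 12 ≤ a ^ 6) (h3 : 3 ≤ d) :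
    (a ^ 5)⁻¹ ≤ sixthRoot m d := by
  have h : (3 : ℝ) ≤ d := by exact_mod_cast h3
  have hd2 : ((d - 2 : ℕ) : ℝ) = (d : ℝ) - 2 := by
    rw [Nat.cast_sub (by omega), Nat.cast_ofNat]
  have hp : 0 < a ^ 60 := pow_pos H.pos _
  unfold sixthRoot
  calc (a ^ 5)⁻¹ = ((a ^ 60)⁻¹) ^ (1 / 12 : ℝ) := by
        rw [Real.inv_rpow hp.le, ← Real.rpow_natCast, ← Real.rpow_natCast,
          ← Real.rpow_mul H.pos.le]
        norm_num
    _ ≤ (w m : ℝ) ^ (1 / 12 : ℝ) :=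
        Real.rpow_le_rpow (by positivity) H.inv_le_w (by norm_num)
    _ ≤ (w m : ℝ) ^ (((d : ℝ) - 2) * (1 / (6 * ((d : ℝ) - 1)))) := by
        refine Real.rpow_le_rpow_of_exponent_le H.one_le_w ?_
        rw [mul_one_div, div_le_div_iff₀ (by norm_num) (by linarith)]
        linarith
    _ = ((w m : ℝ) ^ (d - 2)) ^ (1 / (6 * ((d : ℝ) - 1))) := by
        rw [← Real.rpow_natCast, ← Real.rpow_mul (Nat.cast_nonneg _), hd2]
    _ ≤ (numVars m d : ℝ) ^ (1 / (6 * ((d : ℝ) - 1))) :=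
        Real.rpow_le_rpow (by positivity) (H.w_pow_le_numVars hd (by omega))
          (div_nonneg zero_le_one (mul_nonneg (by norm_num) (by linarith)))

theorem one_add_pow_le {x : ℝ} {s : ℕ} (hx : 0 ≤ x) (h : s * x ≤ 1 / 2) : (1 + x) ^ s ≤ 2 := by
  have h1 : (1 + x) ^ s ≤ Real.exp (s * x) := by
    rw [Real.exp_nat_mul]
    exact pow_le_pow_left₀ (by linarith) (by linarith [Real.add_one_le_exp x]) s
  have h2 : Real.exp (1 / 2) ≤ 2 := by
    have h3 : Real.exp (1 / 2) ^ 2 = Real.exp 1 := by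
      rw [← Real.exp_nat_mul]; norm_num
    have := Real.exp_one_lt_d9
    exact abs_le_of_sq_le_sq' (by linarith) (by norm_num) |>.2
  exact h1.trans ((Real.exp_le_exp.2 h).trans h2)

theorem goodParams (H : Large m a) (hd : (4 * m) ^ d * a ^ 12 ≤ a ^ 6) (h2 : 2 ≤ d) :
    GoodParams m d ⌊sixthRoot m d⌋₊ (18 * a ^ 15) (72 * a ^ 15 * ⌊sixthRoot m d⌋₊) ∧
      72 * a ^ 15 * ⌊sixthRoot m d⌋₊ ≤ 1 / 16 := by
  have hN1 := H.one_le_sixthRoot hd h2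
  have hN2 := H.sixthRoot_le hd h2
  set s := ⌊sixthRoot m d⌋₊ with hs
  have hs1 : 1 ≤ s := Nat.le_floor (by simpa using hN1)
  have hs1' : (1 : ℝ) ≤ s := by exact_mod_cast hs1
  have hsN : (s : ℝ) ≤ 3 * m * (a ^ 10)⁻¹ := (Nat.floor_le (by linarith)).trans hN2
  have ha := H.le_const
  have ha0 := H.pos
  have hm := H.two_le_cast
  have h15 : 0 < a ^ 15 := pow_pos ha0 _
  have h60 : 0 < a ^ 60 := pow_pos ha0 _
  have h30 : 0 < a ^ 30 := pow_pos ha0 _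
  have h75 : 0 < a ^ 75 := pow_pos ha0 _
  have hsa : s * a ^ 15 ≤ a ^ 4 / 2500 := by
    calc s * a ^ 15 ≤ 3 * m * (a ^ 10)⁻¹ * a ^ 15 := by gcongr
      _ = 3 * (m * a ^ 5) := by field_simp
      _ ≤ _ := by linarith [H.mul_pow_succ_le 4, pow_pos ha0 4]
  have h4 : a ^ 4 ≤ 1 / 20000 := by
    have := H.pow_le_pow (show 1 ≤ 4 by norm_num)
    linarith
  have h15s : a ^ 15 ≤ 1 / 20000 := by
    have := H.pow_le_pow (show 1 ≤ 15 by norm_num)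
    linarith
  have h30s : a ^ 30 ≤ a ^ 15 := H.pow_le_pow (by norm_num)
  have h60s : a ^ 60 ≤ 1 / 20000 := by
    have := H.pow_le_pow (show 1 ≤ 60 by norm_num)
    linarith
  have hlam := H.lam_le'
  have h73 : a ^ 73 ≤ a ^ 60 := H.pow_le_pow (by norm_num)
  have hlam1 := H.le_lam
  have e45 : a ^ 30 * a ^ 60 = a ^ 15 * a ^ 75 := by ring
  have hγ : 72 * a ^ 15 * s ≤ 1 / 16 := by nlinarith
  have hhalf : (1 / 2 : ℝ) ^ m = a ^ 60 := by
    rw [one_div, inv_pow, H.two_pow_eq, inv_inv]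
  -- bounds for acceptable blocks
  have hblock : ∀ k n, 2 ≤ k → k ≤ d - 1 → Acceptable m d k n →
      0 ≤ qBlock m d k n ∧ qBlock m d k n ≤ 3 * a ^ 30 := by
    intro k n hk hkd hA
    obtain ⟨hp1, hp2⟩ := H.pow_bounds hd (by omega) hkd hA
    obtain ⟨ht1, ht2⟩ := H.t_bounds hd (k := k - 1) (by omega) (by omega)
    have ht0 : 0 < t m d (k - 1) := by linarith
    unfold qBlock
    refine ⟨div_nonneg (by linarith) ht0.le, ?_⟩
    rw [div_le_iff₀ ht0]
    calc (1 - t m d k) ^ n - lam m ≤ 3 / 2 * a ^ 60 := by linarith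
      _ = 3 * a ^ 30 * (a ^ 30 / 2) := by ring
      _ ≤ _ := by gcongr
  have hu : ∀ k, 1 ≤ k → k ≤ d - 1 → 1 ≤ (1 + t m d k / (1 - t m d k)) ^ s ∧
      (1 + t m d k / (1 - t m d k)) ^ s ≤ 2 := by
    intro k hk hkd
    obtain ⟨ht1, ht2⟩ := H.t_bounds hd hk hkd
    have h1 : 0 ≤ t m d k / (1 - t m d k) := div_nonneg (by linarith) (by linarith)
    refine ⟨one_le_pow₀ (by linarith), one_add_pow_le h1 ?_⟩
    have h3 : t m d k / (1 - t m d k) ≤ 4 * a ^ 15 := by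
      rw [div_le_iff₀ (by linarith)]
      nlinarith
    calc s * (t m d k / (1 - t m d k)) ≤ s * (4 * a ^ 15) := by gcongr
      _ ≤ 1 / 2 := by linarith
  refine ⟨?_, hγ⟩
  refine
    { one_le_s := hs1
      two_le_d := h2
      δ_nonneg := by positivity
      γ_pos := by positivity
      γ_le_one := by linarith
      gain := ?_
      one_le_m := by have := H.two_le; omega
      lam_nonneg := by linarith
      lam_add_q := by rw [H.q_eq]; linarith
      init_block := ?_
      init_full := ?_
      t_nonneg := fun k hk hkd => by linarith [(H.t_bounds hd hk hkd).1]
      t_lt_one := fun k hk hkd => by linarith [(H.t_bounds hd hk hkd).2]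
      pow_lt_one := fun k n hk hkd hA => by linarith [(H.pow_bounds hd (by omega) hkd hA).2]
      qBlock_nonneg := fun k n hk hkd hA => (hblock k n hk hkd hA).1
      lam_add_qBlock := fun k n hk hkd hA => by linarith [(hblock k n hk hkd hA).2]
      subseq_block := ?_
      subseq_full := ?_ }
  · refine one_add_pow_le (by positivity) (le_of_eq ?_)
    field_simp
    norm_num
  · rw [H.q_eq]
    nlinarith
  · rw [H.q_eq, hhalf]
    calc 2 * a ^ 30 * a ^ 60 = 2 * (a ^ 15 * a ^ 75) := by rw [← e45]; ring
      _ ≤ 2 * (a ^ 15 * lam m) := by gcongr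
      _ ≤ 18 * a ^ 15 * lam m * (1 / 2) := by nlinarith [mul_pos h15 (by linarith : 0 < lam m)]
      _ ≤ _ := by
        have : 0 ≤ lam m := by linarith
        gcongr
        linarith
  · intro k n hk hkd hA
    obtain ⟨hq0, hq1⟩ := hblock k n hk hkd hA
    obtain ⟨hu1, hu2⟩ := hu k (by omega) hkd
    calc (1 + t m d k / (1 - t m d k)) ^ s * qBlock m d k n ≤ 2 * (3 * a ^ 30) := by gcongr
      _ ≤ 18 * a ^ 15 * (1 / 2) := by linarith
      _ ≤ _ := by gcongr; linarith
  · intro k n hk hkd hA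
    obtain ⟨hq0, hq1⟩ := hblock k n hk hkd hA
    obtain ⟨hu1, hu2⟩ := hu k (by omega) hkd
    obtain ⟨hp1, hp2⟩ := H.pow_bounds hd (by omega) hkd hA
    have hlam0 : 0 < lam m := by linarith
    calc (1 + t m d k / (1 - t m d k)) ^ s * qBlock m d k n * (1 - t m d k) ^ n
        ≤ 2 * (3 * a ^ 30) * (3 / 2 * a ^ 60) := by
          have : 0 ≤ (1 - t m d k) ^ n := by linarith
          gcongr
      _ = 9 * (a ^ 15 * a ^ 75) := by rw [← e45]; ring
      _ ≤ 9 * (a ^ 15 * lam m) := by gcongr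
      _ = 18 * a ^ 15 * lam m * (1 / 2) := by ring
      _ ≤ _ := by gcongr; linarith

theorem four_mul_pow_le (H : Large m a) (hd : d * logb 2 m ≤ m / 30) :
    (4 * m : ℝ) ^ d * a ^ 12 ≤ a ^ 6 := by
  have hm := H.two_le_cast
  have h6 : 0 < a ^ 6 := pow_pos H.pos _
  have h1 : (4 * m : ℝ) ≤ (m : ℝ) ^ (3 : ℝ) := by
    rw [show (3 : ℝ) = ((3 : ℕ) : ℝ) by norm_num, Real.rpow_natCast]
    have : (4 : ℝ) ≤ m ^ 2 := by nlinarith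
    nlinarith
  have h2 : (4 * m : ℝ) ^ d ≤ 2 ^ ((m : ℝ) / 10) := by
    calc (4 * m : ℝ) ^ d ≤ ((m : ℝ) ^ (3 : ℝ)) ^ d := by gcongr
      _ = (2 : ℝ) ^ (logb 2 m * (3 * d)) := by
        rw [Real.rpow_mul (by norm_num), Real.rpow_logb (by norm_num) (by norm_num) (by linarith),
          Real.rpow_mul (by linarith), Real.rpow_natCast]
      _ ≤ 2 ^ ((m : ℝ) / 10) :=
        Real.rpow_le_rpow_of_exponent_le (by norm_num) (by linarith)
  have h3 : (2 : ℝ) ^ ((m : ℝ) / 10) = (a ^ 6)⁻¹ := by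
    rw [show (m : ℝ) / 10 = m * (1 / 10) by ring, Real.rpow_mul (by norm_num), Real.rpow_natCast,
      H.two_pow_eq, Real.inv_rpow (pow_nonneg H.pos.le _), ← Real.rpow_natCast,
      ← Real.rpow_mul H.pos.le, ← Real.rpow_natCast]
    norm_num
  calc (4 * m : ℝ) ^ d * a ^ 12 ≤ (a ^ 6)⁻¹ * a ^ 12 := by
        rw [← h3]
        have := H.pos
        gcongr
    _ = a ^ 6 := by have := H.pos; field_simp

theorem depth_le (H : Large m a) (hd : (4 * m) ^ d * a ^ 12 ≤ a ^ 6) (h2 : 2 ≤ d)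
    (hdm : d ≤ m) : (d : ℝ) ≤ 2 ^ (2 * sixthRoot m d) := by
  have hN1 := H.one_le_sixthRoot hd h2
  rcases Nat.eq_or_lt_of_le h2 with rfl | h3
  · calc ((2 : ℕ) : ℝ) = 2 ^ (1 : ℝ) := by norm_num
      _ ≤ _ := Real.rpow_le_rpow_of_exponent_le (by norm_num) (by linarith)
  · have h := H.le_sixthRoot hd h3
    have h5 : (m : ℝ) ≤ (a ^ 5)⁻¹ := by
      rw [le_inv_comm₀ (by have := H.two_le_cast; linarith) (pow_pos H.pos _), ← one_div,
        le_div_iff₀ (by have := H.two_le_cast; linarith)]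
      have h6 := H.mul_pow_succ_le 4
      have h7 := H.pow_le_pow (show 1 ≤ 4 by norm_num)
      norm_num only at h6
      linarith [H.le_const]
    have hdm' : (d : ℝ) ≤ m := by exact_mod_cast hdm
    rw [Real.rpow_def_of_pos (by norm_num)]
    have h8 := Real.add_one_le_exp (log 2 * (2 * sixthRoot m d))
    have h9 := Real.log_two_gt_d9
    nlinarith

end Large

/-- The union bound is small. -/
theorem union_bound_le {N γ S : ℝ} {d : ℕ} (hN : 1 ≤ N) (hd : (d : ℝ) ≤ 2 ^ (2 * N))
    (hγ0 : 0 ≤ γ) (hγ : γ ≤ 1 / 16) (hS0 : 0 ≤ S) (hS : S ≤ 2 ^ (1 / 2 * N)) :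
    d * (S * γ ^ (⌊N⌋₊ + 1)) ≤ Real.exp (-(1 / 2 * N)) := by
  have h1 : γ ^ (⌊N⌋₊ + 1) ≤ 2 ^ (-4 * N) := by
    calc γ ^ (⌊N⌋₊ + 1) ≤ (1 / 16) ^ (⌊N⌋₊ + 1) := by gcongr
      _ = 2 ^ (-4 * ((⌊N⌋₊ : ℝ) + 1)) := by
        rw [Real.rpow_mul (by norm_num), show ((⌊N⌋₊ : ℝ) + 1) = ((⌊N⌋₊ + 1 : ℕ) : ℝ) by push_cast; rfl,
          Real.rpow_natCast]
        congr 1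
        rw [Real.rpow_neg (by norm_num)]
        norm_num
      _ ≤ 2 ^ (-4 * N) := by
        refine Real.rpow_le_rpow_of_exponent_le (by norm_num) ?_
        linarith [Nat.lt_floor_add_one N]
  calc d * (S * γ ^ (⌊N⌋₊ + 1)) ≤ 2 ^ (2 * N) * (2 ^ (1 / 2 * N) * 2 ^ (-4 * N)) := by gcongr
    _ = 2 ^ (-(3 / 2) * N) := by
      rw [← Real.rpow_add (by norm_num), ← Real.rpow_add (by norm_num)]
      congr 1
      ring
    _ ≤ Real.exp (-(1 / 2 * N)) := by
      rw [Real.rpow_def_of_pos (by norm_num)]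
      refine Real.exp_le_exp.2 ?_
      nlinarith [Real.log_two_gt_d9]

end SipserProj

theorem mainTheorem10 :
    ∃ c : ℝ, 0 < c ∧ ∃ κ : ℝ, 0 < κ ∧ ∃ m₀ : ℕ, ∀ m d : ℕ, m₀ ≤ m → 2 ≤ d →
      (d : ℝ) ≤ c * √(Real.logb 2 (SipserProj.numVars m d)) / Real.logb 2 (Real.logb 2 (SipserProj.numVars m d)) →
      (d : ℝ) ≤ c * (m : ℝ) / Real.logb 2 m →
      SipserProj.WellDefined m d ∧
      ∀ C : BoolCircuit (SipserProj.Addr m d d), C.Alternating → C.Layered → C.DepthLE d →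
        (C.size : ℝ) ≤ 2 ^ ((1 / 2 : ℝ) * (SipserProj.numVars m d : ℝ) ^ (1 / (6 * ((d : ℝ) - 1)))) →
        (C.isAnd C.out = true →
          1 - Real.exp (-(κ * (SipserProj.numVars m d : ℝ) ^ (1 / (6 * ((d : ℝ) - 1))))) ≤
            massProb (SipserProj.psiMass m d) fun ω =>
              ∃ F : NormalForm (SipserProj.Addr m d 1),
                (F.width : ℝ) ≤ (SipserProj.numVars m d : ℝ) ^ (1 / (4 * ((d : ℝ) - 1))) ∧
                SipserProj.Close m d (1 / (C.size : ℝ)) (SipserProj.psi d ω C.eval) F.evalCNF) ∧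
        (C.isAnd C.out = false →
          1 - Real.exp (-(κ * (SipserProj.numVars m d : ℝ) ^ (1 / (6 * ((d : ℝ) - 1))))) ≤
            massProb (SipserProj.psiMass m d) fun ω =>
              ∃ F : NormalForm (SipserProj.Addr m d 1),
                (F.width : ℝ) ≤ (SipserProj.numVars m d : ℝ) ^ (1 / (4 * ((d : ℝ) - 1))) ∧
                SipserProj.Close m d (1 / (C.size : ℝ)) (SipserProj.psi d ω C.eval) F.evalDNF) := by
  obtain ⟨m₀, hm₀⟩ := SipserProj.exists_large
  refine ⟨1 / 30, by norm_num, 1 / 2, by norm_num, m₀, fun m d hm h2 _ hdm => ?_⟩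
  obtain ⟨a, H⟩ := hm₀ m hm
  have hm2 := H.two_le_cast
  have hlog : 1 ≤ Real.logb 2 m := by
    rw [Real.le_logb_iff_rpow_le (by norm_num) (by linarith), Real.rpow_one]
    exact hm2
  have hdlog : d * Real.logb 2 m ≤ m / 30 := by
    rw [le_div_iff₀ (by linarith)] at hdm
    linarith
  have hd0 : (0 : ℝ) ≤ d := Nat.cast_nonneg d
  have hdm' : d ≤ m := by
    have : (d : ℝ) ≤ m := by nlinarith
    exact_mod_cast this
  have hpow := H.four_mul_pow_le hdlog
  obtain ⟨hG, hγ⟩ := H.goodParams hpow h2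
  refine ⟨hG.wellDefined, fun C _ _ hC hS => ?_⟩
  have hN1 := H.one_le_sixthRoot hpow h2
  have hbad := (hG.massProb_psi_le C hC).trans (SipserProj.union_bound_le hN1
    (H.depth_le hpow h2 hdm') hG.γ_pos.le hγ (Nat.cast_nonneg _) hS)
  have hgood : 1 - Real.exp (-(1 / 2 * SipserProj.sixthRoot m d)) ≤
      massProb (SipserProj.psiMass m d) fun ω =>
        SipserProj.TopSmall C ⌊SipserProj.sixthRoot m d⌋₊ (SipserProj.subst d ω) := by
    rw [massProb_not hG.isProbMass_psiMass]
    linarith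
  have hwidth : ∀ W : ℕ, W ≤ ⌊SipserProj.sixthRoot m d⌋₊ →
      (W : ℝ) ≤ (SipserProj.numVars m d : ℝ) ^ (1 / (4 * ((d : ℝ) - 1))) := by
    intro W hW
    have hd2 : (2 : ℝ) ≤ d := by exact_mod_cast h2
    calc (W : ℝ) ≤ ⌊SipserProj.sixthRoot m d⌋₊ := by exact_mod_cast hW
      _ ≤ SipserProj.sixthRoot m d := Nat.floor_le (by linarith)
      _ ≤ _ := Real.rpow_le_rpow_of_exponent_le (H.one_le_numVars hpow h2)
        (one_div_le_one_div_of_le (by linarith) (by linarith))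
  have hε : 0 ≤ 1 / (C.size : ℝ) := by positivity
  refine ⟨fun hA => hgood.trans (massProb_mono hG.isProbMass_psiMass.1 fun ω hω => ?_),
    fun hA => hgood.trans (massProb_mono hG.isProbMass_psiMass.1 fun ω hω => ?_)⟩
  · obtain ⟨F, h3, h4⟩ := hω.exists_cnf hA hG.one_le_s
    exact ⟨F, hwidth _ h3, SipserProj.close_of_eq hε h4⟩
  · obtain ⟨F, h3, h4⟩ := hω.exists_dnf hA hG.one_le_s
    exact ⟨F, hwidth _ h3, SipserProj.close_of_eq hε h4⟩
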